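/- **Setting.** Let $\Theta\subseteq\mathbb{R}^p$ be measurable, let $k$ be a continuous covariance function on $\Theta^2$, $h_1,\dots,h_r:\Theta\to\mathbb{R}$ continuous, $b\in\mathbb{R}^r$, $B\in\mathbb{R}^{r\times r}$ symmetric positive definite, $\sigma_n>0$, $\epsilon\in\mathbb{R}$, and let $\pi$ be a probability density on $\Theta$. Discrepancies are modelled as $\Delta_i=f(\theta_i)+\nu_i$ with i.i.d. $\nu_i\sim N(0,\sigma_n^2)$, where $f\mid\gamma\sim \mathrm{GP}(\sum_i\gamma_ih_i,k)$ and $\gamma\sim N(b,B)$. For data $D=\{(\Delta_i,\theta_i)\}_{i=1}^n$ put $K=[k(\theta_i,\theta_j)+1_{i=j}\sigma_n^2]_{ij}$, $k_D(\theta)=(k(\theta,\theta_i))_{i}$, $\Delta=(\Delta_i)_i$, $h(\theta)=(h_a(\theta))_{a}$, $H=[h_a(\theta_i)]_{ai}$, $R(\theta)=h(\theta)-HK^{-1}k_D(\theta)$, $G=B^{-1}+HK^{-1}H^\top$, $\bar\gamma=G^{-1}(HK^{-1}\Delta+B^{-1}b)$. The posterior of $f$ given $D$ is $\Pi_D=\mathrm{GP}(m_D,c_D)$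 with $$m_D(\theta)=k_D(\theta)^\top K^{-1}\Delta+R(\theta)^\top\bar\gamma,\qquad c_D(\theta,\theta')=k(\theta,\theta')-k_D(\theta)^\top K^{-1}k_D(\theta')+R(\theta)^\top G^{-1}R(\theta').$$ The unnormalised ABC posterior is $\tilde\pi^f(\theta)=\pi(\theta)\Phi((\epsilon-f(\theta))/\sigma_n)$, with $\Phi$ the standard normal cdf. For current data $D_t$ write $m_t=m_{D_t}$, $c_t=c_{D_t}$, $s_t^2(\theta)=c_t(\theta,\theta)$ and $a_t(\theta)=(\epsilon-m_t(\theta))/\sqrt{\sigma_n^2+s_t^2(\theta)}$. For a batch $\theta^*=(\theta^*_1,\dots,\theta^*_q)\in\Theta^q$ let $\Delta^*$ have coordinates $\Delta^*_i=f(\theta_i^*)+\nu_i^*$, with $f\sim\Pi_{D_t}$ and i.i.d. $\nu_i^*\sim N(0,\sigma_n^2)$ independent of $f$, and let $D^*=\{(\Delta_i^*,\theta_i^*)\}_{i=1}^q$. The acquisition functions are $$L_t^{\mathrm v}(\theta^*)=\mathbb{E}_{\Delta^*}\min_{d\in L^2(\Theta)}\mathbb{E}_{f\sim\Pi_{D_t\cup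 D^*}}\int_\Theta(\tilde\pi^f-d)^2\,d\theta,\qquad L_t^{\mathrm m}(\theta^*)=\mathbb{E}_{\Delta^*}\min_{d\in L^1(\Theta)}\mathbb{E}_{f\sim\Pi_{D_t\cup D^*}}\int_\Theta|\tilde\pi^f-d|\,d\theta$$ (EIV and EIMAD respectively), where in the inner expectations $f$ is a jointly measurable process with law $\Pi_{D_t\cup D^*}$. Let $T(h,a)=\frac1{2\pi}\int_0^a\frac{e^{-h^2(1+x^2)/2}}{1+x^2}\,dx$ be Owen's T function, and $$\tau_t^2(\theta;\theta^*)=c_t(\theta,\theta^*)[c_t(\theta^*,\theta^*)+\sigma_n^2I]^{-1}c_t(\theta^*,\theta).$$ **Proposition.** (i) If, for every value of $\Delta^*$, $\tilde\pi^f\in L^2(\Theta)$ for $\Pi_{D_t\cup D^*}$-almost every $f$ (for instance if $\pi\in L^2(\Theta)$), then the minima in $L_t^{\mathrm v}$ are attained and $$L_t^{\mathrm v}(\theta^*)=2\int_\Theta\pi^2(\theta)\left[T\!\left(a_t(\theta),\frac{\sqrt{\sigma_n^2+s_t^2(\theta)-\tau_t^2(\theta;\theta^*)}}{\sqrt{\sigma_n^2+s_t^2(\theta)+\tau_t^2(\theta;\theta^*)}}\right)-T\!\left(a_t(\theta),\frac{\sigma_n}{\sqrt{\sigma_n^2+2s_t^2(\theta)}}\right)\right]d\theta,$$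 an identity in $[0,\infty]$ with nonnegative integrand; if $\pi\in L^2(\Theta)$, both sides are finite. (ii) The minima in $L_t^{\mathrm m}$ are attained and $$L_t^{\mathrm m}(\theta^*)=2\int_\Theta\pi(\theta)\,T\!\left(a_t(\theta),\frac{\sqrt{s_t^2(\theta)-\tau_t^2(\theta;\theta^*)}}{\sqrt{\sigma_n^2+\tau_t^2(\theta;\theta^*)}}\right)d\theta,$$ with a nonnegative, integrable integrand. -/

import Mathlib

open MeasureTheory ProbabilityTheory Matrix
open scoped NNReal ENNReal

attribute [local instance] MeasureTheory.Measure.Subtype.measureSpace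

noncomputable section

namespace BayesABC

/-- The standard normal cdf `Φ`. -/
def stdNormalCdf (x : ℝ) : ℝ := cdf (gaussianReal 0 1) x

/-- Owen's T function
`T(h, a) = (2π)⁻¹ ∫₀ᵃ exp(-h² (1 + x²) / 2) / (1 + x²) dx`. -/
def owenT (h a : ℝ) : ℝ :=
  (2 * Real.pi)⁻¹ * ∫ x in (0 : ℝ)..a, Real.exp (-(h ^ 2 * (1 + x ^ 2)) / 2) / (1 + x ^ 2)

/-- `k` is a covariance function: all its Gram matrices are symmetric positive semidefinite. -/
def IsCovarianceFunction {T : Type*} (k : T → T → ℝ) : Prop :=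
  ∀ (n : ℕ) (x : Fin n → T), (Matrix.of fun i j => k (x i) (x j)).PosSemidef

/-- The Bayesian ABC model on a parameter space `Θ ⊆ ℝᵖ`: hierarchical GP prior
`f | γ ~ GP(∑ᵢ γᵢ hᵢ, k)`, `γ ~ N(b, B)` for the discrepancy mean, noise variance `σ² > 0`,
ABC threshold `ε`, and prior density `prior` on `Θ`. -/
structure Model {p : ℕ} (Θ : Set (EuclideanSpace ℝ (Fin p))) (r : ℕ) where
  k : Θ → Θ → ℝ
  k_continuous : Continuous (Function.uncurry k)
  k_covariance : IsCovarianceFunction k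
  h : Fin r → Θ → ℝ
  h_continuous : ∀ a, Continuous (h a)
  b : Fin r → ℝ
  B : Matrix (Fin r) (Fin r) ℝ
  B_posDef : B.PosDef
  σ : ℝ
  σ_pos : 0 < σ
  ε : ℝ
  prior : Θ → ℝ
  prior_measurable : Measurable prior
  prior_nonneg : ∀ θ, 0 ≤ prior θ
  prior_lintegral : ∫⁻ θ, ENNReal.ofReal (prior θ) = 1

/-- Discrepancy data: locations `loc i` with observed discrepancies `val i`. -/
structure Data {p : ℕ} (Θ : Set (EuclideanSpace ℝ (Fin p))) (ι : Type*) where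
  loc : ι → Θ
  val : ι → ℝ

/-- The data set obtained by merging two data sets. -/
def Data.union {p : ℕ} {Θ : Set (EuclideanSpace ℝ (Fin p))} {ι κ : Type*}
    (D : Data Θ ι) (D' : Data Θ κ) : Data Θ (ι ⊕ κ) where
  loc := Sum.elim D.loc D'.loc
  val := Sum.elim D.val D'.val

section Posterior

variable {p : ℕ} {Θ : Set (EuclideanSpace ℝ (Fin p))} {r : ℕ} (M : Model Θ r)
variable {ι : Type*} [Fintype ι] [DecidableEq ι]

/-- `[K]ᵢⱼ = k(θᵢ, θⱼ) + 1_{i = j} σ²`. -/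
def Model.gram (x : ι → Θ) : Matrix ι ι ℝ :=
  Matrix.of fun i j => M.k (x i) (x j) + if i = j then M.σ ^ 2 else 0

/-- The vector `(k(θ, θ₁), …, k(θ, θ_t))`. -/
def Model.kvec (x : ι → Θ) (θ : Θ) : ι → ℝ := fun i => M.k θ (x i)

/-- The `r × t` matrix of basis function values at the data locations. -/
def Model.basisMatrix (x : ι → Θ) : Matrix (Fin r) ι ℝ := Matrix.of fun a i => M.h a (x i)

/-- `R(θ) = H(θ) - H K⁻¹ k(θ)`. -/
def Model.resid (x : ι → Θ) (θ : Θ) : Fin r → ℝ :=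
  (fun a => M.h a θ) - M.basisMatrix x *ᵥ ((M.gram x)⁻¹ *ᵥ M.kvec x θ)

/-- `B⁻¹ + H K⁻¹ Hᵀ`. -/
def Model.precision (x : ι → Θ) : Matrix (Fin r) (Fin r) ℝ :=
  M.B⁻¹ + M.basisMatrix x * (M.gram x)⁻¹ * (M.basisMatrix x)ᵀ

/-- The generalised least-squares estimate
`γ̄ = [B⁻¹ + H K⁻¹ Hᵀ]⁻¹ (H K⁻¹ Δ + B⁻¹ b)`. -/
def Model.gammaBar (D : Data Θ ι) : Fin r → ℝ :=
  (M.precision D.loc)⁻¹ *ᵥ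
    (M.basisMatrix D.loc *ᵥ ((M.gram D.loc)⁻¹ *ᵥ D.val) + M.B⁻¹ *ᵥ M.b)

/-- GP posterior mean `m(θ) = k(θ) K⁻¹ Δ + R(θ)ᵀ γ̄`. -/
def Model.postMean (D : Data Θ ι) (θ : Θ) : ℝ :=
  M.kvec D.loc θ ⬝ᵥ ((M.gram D.loc)⁻¹ *ᵥ D.val) + M.resid D.loc θ ⬝ᵥ M.gammaBar D

/-- GP posterior covariance
`c(θ, θ') = k(θ, θ') - k(θ) K⁻¹ k(θ')ᵀ + R(θ)ᵀ [B⁻¹ + H K⁻¹ Hᵀ]⁻¹ R(θ')`;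
it depends on the data only through the locations. -/
def Model.postCov (x : ι → Θ) (θ θ' : Θ) : ℝ :=
  M.k θ θ' - M.kvec x θ ⬝ᵥ ((M.gram x)⁻¹ *ᵥ M.kvec x θ')
    + M.resid x θ ⬝ᵥ ((M.precision x)⁻¹ *ᵥ M.resid x θ')

/-- GP posterior variance `s²(θ) = c(θ, θ)`. -/
def Model.postVar (x : ι → Θ) (θ : Θ) : ℝ := M.postCov x θ θ

/-- `a(θ) = (ε - m(θ)) / √(σ² + s²(θ))`. -/
def Model.aFun (D : Data Θ ι) (θ : Θ) : ℝ :=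
  (M.ε - M.postMean D θ) / √(M.σ ^ 2 + M.postVar D.loc θ)

/-- The matrix `c(θ*, θ*)`. -/
def Model.postCovMatrix (x : ι → Θ) {q : ℕ} (xs : Fin q → Θ) : Matrix (Fin q) (Fin q) ℝ :=
  Matrix.of fun i j => M.postCov x (xs i) (xs j)

/-- The variance reduction
`τ²(θ; θ*) = c(θ, θ*) [c(θ*, θ*) + σ² I]⁻¹ c(θ*, θ)`. -/
def Model.tauSq (x : ι → Θ) {q : ℕ} (xs : Fin q → Θ) (θ : Θ) : ℝ :=
  (fun i => M.postCov x θ (xs i)) ⬝ᵥ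
    ((M.postCovMatrix x xs + M.σ ^ 2 • (1 : Matrix (Fin q) (Fin q) ℝ))⁻¹ *ᵥ
      fun i => M.postCov x (xs i) θ)

/-- The law of the future discrepancies `Δ* | θ*, D`: `Δ*ᵢ = f(θ*ᵢ) + νᵢ`, where
`f ~ GP(m, c)` is the current GP posterior and the `νᵢ ~ N(0, σ²)` are i.i.d. and independent
of `f`. -/
def Model.predictive (D : Data Θ ι) {q : ℕ} (xs : Fin q → Θ) : Measure (Fin q → ℝ) :=
  ((multivariateGaussian (WithLp.toLp 2 fun i => M.postMean D (xs i))
      (M.postCovMatrix D.loc xs)).prod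
    (Measure.pi fun _ : Fin q => gaussianReal 0 (M.σ ^ 2).toNNReal)).map
      fun y i => y.1 i + y.2 i

end Posterior

/-- `f` is a (jointly measurable) process with law `GP(m, c)` under `P`. -/
structure IsGP {T Ω : Type*} [MeasurableSpace T] [MeasurableSpace Ω]
    (f : T → Ω → ℝ) (m : T → ℝ) (c : T → T → ℝ) (P : Measure Ω) : Prop where
  measurable : Measurable (Function.uncurry f)
  gaussian : IsGaussianProcess f P
  mean : ∀ θ, ∫ ω, f θ ω ∂P = m θ
  covariance : ∀ θ θ', cov[f θ, f θ'; P] = c θ θ'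

section Decision

variable {p : ℕ} {Θ : Set (EuclideanSpace ℝ (Fin p))} {r : ℕ} (M : Model Θ r)

/-- The unnormalised ABC posterior `θ ↦ π(θ) Φ((ε - f(θ)) / σ)`. -/
def Model.unnormABC (f : Θ → ℝ) (θ : Θ) : ℝ :=
  M.prior θ * stdNormalCdf ((M.ε - f θ) / M.σ)

/-- The `L²` loss `∫_Θ (g - d)²`. -/
def lossL2 (g d : Θ → ℝ) : ℝ≥0∞ := ∫⁻ θ, ENNReal.ofReal ((g θ - d θ) ^ 2)

/-- The `L¹` loss `∫_Θ |g - d|`. -/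
def lossL1 (g d : Θ → ℝ) : ℝ≥0∞ := ∫⁻ θ, ENNReal.ofReal |g θ - d θ|

variable {Ω : Type*} [MeasurableSpace Ω]

/-- The expected `L²` loss of the estimator `d`, for the random function `f` under `P`. -/
def Model.expLossL2 (f : Θ → Ω → ℝ) (P : Measure Ω) (d : Θ → ℝ) : ℝ≥0∞ :=
  ∫⁻ ω, lossL2 (M.unnormABC fun θ => f θ ω) d ∂P

/-- The expected `L¹` loss of the estimator `d`, for the random function `f` under `P`. -/
def Model.expLossL1 (f : Θ → Ω → ℝ) (P : Measure Ω) (d : Θ → ℝ) : ℝ≥0∞ :=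
  ∫⁻ ω, lossL1 (M.unnormABC fun θ => f θ ω) d ∂P

/-- The Bayes risk for the `L²` loss; the estimators are the functions in `L²(Θ)`. -/
def Model.riskL2 (f : Θ → Ω → ℝ) (P : Measure Ω) : ℝ≥0∞ :=
  ⨅ (d : Θ → ℝ) (_ : MemLp d 2), M.expLossL2 f P d

/-- The Bayes risk for the `L¹` loss; the estimators are the functions in `L¹(Θ)`. -/
def Model.riskL1 (f : Θ → Ω → ℝ) (P : Measure Ω) : ℝ≥0∞ :=
  ⨅ (d : Θ → ℝ) (_ : MemLp d 1), M.expLossL1 f P d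

variable {ι : Type*} [Fintype ι] [DecidableEq ι]

/-- `f δ`, on the probability space `(Ω, P δ)`, is a version of the GP posterior given the merged
data `D ∪ D*`, where `D*` consists of the values `δ` at the locations `xs`, for every `δ`. -/
def Model.IsLookahead (D : Data Θ ι) {q : ℕ} (xs : Fin q → Θ)
    (f : (Fin q → ℝ) → Θ → Ω → ℝ) (P : (Fin q → ℝ) → Measure Ω) : Prop :=
  ∀ δ : Fin q → ℝ, IsGP (f δ) (M.postMean (D.union ⟨xs, δ⟩))
    (M.postCov (D.union ⟨xs, δ⟩).loc) (P δ)

/-- The expected integrated variance acquisition function: the expectation over the future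
discrepancies of the `L²` Bayes risk of the GP posterior given the merged data. -/
def Model.EIV (D : Data Θ ι) {q : ℕ} (xs : Fin q → Θ)
    (f : (Fin q → ℝ) → Θ → Ω → ℝ) (P : (Fin q → ℝ) → Measure Ω) : ℝ≥0∞ :=
  ∫⁻ δ, M.riskL2 (f δ) (P δ) ∂(M.predictive D xs)

/-- The expected integrated MAD acquisition function: the expectation over the future
discrepancies of the `L¹` Bayes risk of the GP posterior given the merged data. -/
def Model.EIMAD (D : Data Θ ι) {q : ℕ} (xs : Fin q → Θ)
    (f : (Fin q → ℝ) → Θ → Ω → ℝ) (P : (Fin q → ℝ) → Measure Ω) : ℝ≥0∞ :=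
  ∫⁻ δ, M.riskL1 (f δ) (P δ) ∂(M.predictive D xs)

/-- The integrand of the closed form of EIV. -/
def Model.eivIntegrand (D : Data Θ ι) {q : ℕ} (xs : Fin q → Θ) (θ : Θ) : ℝ :=
  M.prior θ ^ 2 *
    (owenT (M.aFun D θ)
        (√(M.σ ^ 2 + M.postVar D.loc θ - M.tauSq D.loc xs θ) /
          √(M.σ ^ 2 + M.postVar D.loc θ + M.tauSq D.loc xs θ))
      - owenT (M.aFun D θ) (M.σ / √(M.σ ^ 2 + 2 * M.postVar D.loc θ)))

/-- The integrand of the closed form of EIMAD. -/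
def Model.eimadIntegrand (D : Data Θ ι) {q : ℕ} (xs : Fin q → Θ) (θ : Θ) : ℝ :=
  M.prior θ *
    owenT (M.aFun D θ)
      (√(M.postVar D.loc θ - M.tauSq D.loc xs θ) / √(M.σ ^ 2 + M.tauSq D.loc xs θ))

end Decision

end BayesABC

end

/-! Both acquisition functions reduce, pointwise in `θ`, to integrals over two independent standard
normals.

Bayes risk. By Tonelli the expected loss of `d` is an integral over `θ` of a scalar problem for
`π(θ) Φ((ε - f(θ)) / σ)`, which involves only the one-dimensional normal law of `f(θ)`. The squared
loss is minimised by the mean, leaving a variance (`Model.riskL2_eq`). The absolute loss is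
minimised by the median, which is `π(θ) Φ((ε - m(θ)) / σ)` because `Φ` is monotone
(`Model.riskL1_eq`).

Look-ahead. Integrating out `γ` turns the prior into a GP with mean `hᵀb` and covariance `k + hᵀBh`,
and the given posterior formulas are conditioning of this GP: their kriging weights solve the normal
equations (`Model.obsCov_mulVec_weights`). Uniqueness of that solution gives the weights for the
merged data (`Model.weights_union`). So the new variance is `s² - τ²` whatever the values of `Δ*`,
while the new mean is affine in `Δ*` and has law `N(m, τ²)` (`Model.predictive_map_postMean`). After
another use of Tonelli, `f(θ)` is represented by `m + τ Y + √(s² - τ²) Z`, where `Y` carries the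
future data and `Z` the remaining uncertainty.

Gaussian integrals. Writing `Φ` as a probability and using the orthogonal invariance of the planar
Gaussian measure, one finds that averaging `Φ` over a normal argument gives `Φ`, averaging `Φ²`
gives `Φ - 2T`, and averaging `Φ` against the sign of the normal variable gives `2T`. In the
expected variance the two `Φ` terms cancel and a difference of `T` values remains; the expected
absolute deviation is a single `T`. -/

noncomputable section

namespace BayesABC

/-! ### The standard normal cdf -/

section StdNormalCdf

lemma stdNormalCdf_eq_real (x : ℝ) : stdNormalCdf x = (gaussianReal 0 1).real (Set.Iic x) :=
  cdf_eq_real _ x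

lemma stdNormalCdf_nonneg (x : ℝ) : 0 ≤ stdNormalCdf x := cdf_nonneg _ x

lemma stdNormalCdf_le_one (x : ℝ) : stdNormalCdf x ≤ 1 := cdf_le_one _ x

lemma monotone_stdNormalCdf : Monotone stdNormalCdf := monotone_cdf _

@[fun_prop]
lemma measurable_stdNormalCdf : Measurable stdNormalCdf := monotone_stdNormalCdf.measurable

lemma stdNormalCdf_eq_integral (x : ℝ) :
    stdNormalCdf x = ∫ z, (Set.Iic x).indicator 1 z ∂(gaussianReal 0 1) := by
  rw [stdNormalCdf_eq_real, integral_indicator_one measurableSet_Iic]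

lemma integral_gaussianReal_comp_neg (F : ℝ → ℝ) :
    ∫ z, F (-z) ∂(gaussianReal 0 1) = ∫ z, F z ∂(gaussianReal 0 1) := by
  have h : MeasurePreserving (MeasurableEquiv.neg ℝ) (gaussianReal 0 1) (gaussianReal 0 1) := by
    refine ⟨by fun_prop, ?_⟩
    have := gaussianReal_map_neg (μ := 0) (v := 1)
    rwa [neg_zero] at this
  exact h.integral_comp' F

lemma stdNormalCdf_neg (x : ℝ) : stdNormalCdf (-x) = 1 - stdNormalCdf x := by
  have hna : NullSingletonClass (gaussianReal 0 1) :=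
    nullSingletonClass_gaussianReal (by simp)
  rw [stdNormalCdf_eq_integral, ← integral_gaussianReal_comp_neg, stdNormalCdf_eq_real,
    ← probReal_compl_eq_one_sub measurableSet_Iic, Set.compl_Iic,
    measureReal_congr (Ioi_ae_eq_Ici (a := x)), ← integral_indicator_one measurableSet_Ici]
  congr 1
  ext z
  simp [Set.indicator]

lemma stdNormalCdf_zero : stdNormalCdf 0 = 1 / 2 := by
  have := stdNormalCdf_neg 0
  rw [neg_zero] at this
  linarith

lemma stdNormalCdf_sub_half (x : ℝ) :
    stdNormalCdf x - 1 / 2 = ∫ y in (0 : ℝ)..x, gaussianPDFReal 0 1 y := by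
  have h (x : ℝ) : stdNormalCdf x = ∫ y in Set.Iic x, gaussianPDFReal 0 1 y := by
    rw [stdNormalCdf_eq_real, measureReal_def, gaussianReal_apply_eq_integral _ (by simp),
      ENNReal.toReal_ofReal]
    exact integral_nonneg fun y => gaussianPDFReal_nonneg _ _ _
  rw [← stdNormalCdf_zero, h, h, intervalIntegral.integral_Iic_sub_Iic] <;>
  exact (integrable_gaussianPDFReal _ _).integrableOn

end StdNormalCdf

/-! ### Rotation invariance of the planar standard Gaussian measure -/

section Rotation

/-- The characteristic function depends only on the Euclidean norm of the functional, which an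
orthogonal map preserves. The map chosen is a reflection, hence its own inverse, so one formula
serves as the change of variables in both directions. -/
lemma map_rotation_gaussianReal_prod {α β : ℝ} (h : α ^ 2 + β ^ 2 = 1) :
    ((gaussianReal 0 1).prod (gaussianReal 0 1)).map
      (fun p : ℝ × ℝ => (α * p.1 + β * p.2, β * p.1 - α * p.2)) =
    (gaussianReal 0 1).prod (gaussianReal 0 1) := by
  let f : ℝ × ℝ →L[ℝ] ℝ × ℝ :=
    (α • ContinuousLinearMap.fst ℝ ℝ ℝ + β • ContinuousLinearMap.snd ℝ ℝ ℝ).prod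
      (β • ContinuousLinearMap.fst ℝ ℝ ℝ - α • ContinuousLinearMap.snd ℝ ℝ ℝ)
  have hf : (fun p : ℝ × ℝ => (α * p.1 + β * p.2, β * p.1 - α * p.2)) = f := by
    ext p <;> simp [f]
  have key (L : StrongDual ℝ ℝ) :
      charFunDual (gaussianReal 0 1) L = Complex.exp (-((L 1 : ℝ) : ℂ) ^ 2 / 2) := by
    rw [charFunDual_eq_charFun_map_one, gaussianReal_map_continuousLinearMap, charFun_gaussianReal]
    congr 1
    have : max (L 1 ^ 2) 0 = L 1 ^ 2 := max_eq_left (sq_nonneg _)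
    simp [this]
    ring
  rw [hf]
  have : IsProbabilityMeasure (((gaussianReal 0 1).prod (gaussianReal 0 1)).map f) :=
    Measure.isProbabilityMeasure_map (by fun_prop)
  apply Measure.ext_of_charFunDual
  ext L
  rw [charFunDual_map, charFunDual_prod, charFunDual_prod, key, key, key, key, ← Complex.exp_add,
    ← Complex.exp_add]
  have hL (a b : ℝ) : L (a, b) = a * L (1, 0) + b * L (0, 1) := by
    have : ((a, b) : ℝ × ℝ) = a • (1, 0) + b • (0, 1) := by ext <;> simp
    rw [this, map_add, map_smul, map_smul]
    simp
  congr 1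
  simp only [ContinuousLinearMap.comp_apply, f, ContinuousLinearMap.inl_apply,
    ContinuousLinearMap.inr_apply, ContinuousLinearMap.prod_apply, _root_.add_apply,
    _root_.sub_apply, _root_.smul_apply, ContinuousLinearMap.coe_fst',
    ContinuousLinearMap.coe_snd', smul_eq_mul, mul_one, mul_zero, add_zero, zero_add, sub_zero,
    zero_sub]
  rw [hL α β, hL β (-α)]
  have h' : (α : ℂ) ^ 2 + (β : ℂ) ^ 2 = 1 := by exact_mod_cast h
  push_cast
  linear_combination (-((L (1, 0) : ℂ) ^ 2 + (L (0, 1) : ℂ) ^ 2) / 2) * h'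

lemma integral_rotation_gaussianReal {α β : ℝ} (h : α ^ 2 + β ^ 2 = 1) {F : ℝ × ℝ → ℝ}
    (hF : Measurable F) {C : ℝ} (hC : ∀ p, |F p| ≤ C) :
    ∫ x, ∫ y, F (α * x + β * y, β * x - α * y) ∂(gaussianReal 0 1) ∂(gaussianReal 0 1) =
    ∫ x, ∫ y, F (x, y) ∂(gaussianReal 0 1) ∂(gaussianReal 0 1) := by
  have hint (F : ℝ × ℝ → ℝ) (hF : Measurable F) (hC : ∀ p, |F p| ≤ C) :
      Integrable F ((gaussianReal 0 1).prod (gaussianReal 0 1)) :=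
    Integrable.of_bound hF.aestronglyMeasurable C (.of_forall hC)
  rw [← integral_prod _ (hint F hF hC),
    ← integral_prod (fun p : ℝ × ℝ => F (α * p.1 + β * p.2, β * p.1 - α * p.2))
      (hint _ (by fun_prop) fun p => hC _)]
  conv_rhs => rw [← map_rotation_gaussianReal_prod h]
  rw [integral_map (by fun_prop) hF.aestronglyMeasurable]

lemma map_affine_gaussianReal (m : ℝ) {v : ℝ} (hv : 0 ≤ v) :
    (gaussianReal 0 1).map (fun z => m + √v * z) = gaussianReal m v.toNNReal := by
  have h : (fun z : ℝ => m + √v * z) = (fun z => m + z) ∘ fun z => √v * z := rfl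
  rw [h, ← Measure.map_map (by fun_prop) (by fun_prop), gaussianReal_map_const_mul,
    gaussianReal_map_const_add]
  congr 1
  · ring
  · ext
    simp [Real.sq_sqrt hv, hv]

lemma map_mul_gaussianReal (c : ℝ) :
    (gaussianReal 0 1).map (c * ·) = gaussianReal 0 (c ^ 2).toNNReal := by
  rw [gaussianReal_map_const_mul]
  congr 1
  · ring
  · ext
    simp [sq_nonneg]

/-- Variances add: `t Y + s Z` has the law of a single centred normal, by convolution. -/
lemma integral_gaussianReal_comp_add (s t : ℝ) {F : ℝ → ℝ} (hF : Measurable F) {C : ℝ}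
    (hC : ∀ p, |F p| ≤ C) :
    ∫ y, ∫ z, F (t * y + s * z) ∂(gaussianReal 0 1) ∂(gaussianReal 0 1) =
    ∫ z, F (√(t ^ 2 + s ^ 2) * z) ∂(gaussianReal 0 1) := by
  have h1 (c : ℝ) (G : ℝ → ℝ) (hG : Measurable G) :
      ∫ z, G (c * z) ∂(gaussianReal 0 1) = ∫ x, G x ∂(gaussianReal 0 (c ^ 2).toNNReal) := by
    rw [← map_mul_gaussianReal, integral_map (by fun_prop) hG.aestronglyMeasurable]
  have e : gaussianReal 0 (√(t ^ 2 + s ^ 2) ^ 2).toNNReal =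
      gaussianReal 0 (t ^ 2).toNNReal ∗ gaussianReal 0 (s ^ 2).toNNReal := by
    rw [gaussianReal_conv_gaussianReal, add_zero, Real.sq_sqrt (by positivity),
      Real.toNNReal_add (by positivity) (by positivity)]
  have : IsFiniteMeasure (gaussianReal 0 (t ^ 2).toNNReal ∗ gaussianReal 0 (s ^ 2).toNNReal) := by
    rw [← e]
    infer_instance
  rw [h1 _ F hF, e, integral_conv (Integrable.of_bound hF.aestronglyMeasurable C (.of_forall hC)),
    ← h1 t (fun x => ∫ y, F (x + y) ∂(gaussianReal 0 (s ^ 2).toNNReal))]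
  · congr 1
    ext y
    rw [h1 s (fun z => F (t * y + z)) (by fun_prop)]
  · have : Measurable fun p : ℝ × ℝ => F (p.1 + p.2) := by fun_prop
    exact this.stronglyMeasurable.integral_prod_right.measurable

end Rotation

/-! ### Gaussian integrals of the normal cdf -/

section Owen

/-- With an independent standard normal `Y`, `Φ((c - s z) / v)` is the probability of `s z + v Y ≤
c`; averaging over `z` leaves one normal variable of variance `v² + s²`. -/
lemma integral_stdNormalCdf_affine (c s : ℝ) {v : ℝ} (hv : 0 < v) :
    ∫ z, stdNormalCdf ((c - s * z) / v) ∂(gaussianReal 0 1) =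
      stdNormalCdf (c / √(v ^ 2 + s ^ 2)) := by
  have hw : 0 < √(s ^ 2 + v ^ 2) := by positivity
  have hind (c : ℝ) : Measurable ((Set.Iic c).indicator (1 : ℝ → ℝ)) :=
    measurable_one.indicator measurableSet_Iic
  calc ∫ z, stdNormalCdf ((c - s * z) / v) ∂(gaussianReal 0 1)
      = ∫ y, ∫ z, (Set.Iic c).indicator 1 (s * y + v * z) ∂(gaussianReal 0 1)
          ∂(gaussianReal 0 1) := by
        simp_rw [stdNormalCdf_eq_integral]
        congr! 4 with y z
        simp only [Set.indicator, Set.mem_Iic, le_div_iff₀ hv]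
        congr 1
        ext
        constructor <;> intro <;> linarith
    _ = ∫ z, (Set.Iic c).indicator 1 (√(s ^ 2 + v ^ 2) * z) ∂(gaussianReal 0 1) := by
        refine integral_gaussianReal_comp_add v s (hind c) (C := 1) fun p => ?_
        simp only [Set.indicator]
        split_ifs <;> simp
    _ = _ := by
        rw [add_comm (v ^ 2), stdNormalCdf_eq_integral]
        congr! 2 with z
        simp only [Set.indicator, Set.mem_Iic, le_div_iff₀ hw]
        rw [mul_comm z]
        rfl

/-- The substitution `y = u x` makes the range of integration independent of `u`, ready for Fubini.
-/
lemma stdNormalCdf_mul_sub_half (a u : ℝ) :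
    stdNormalCdf (a * u) - 1 / 2 =
      ∫ x in (0 : ℝ)..a, (√(2 * Real.pi))⁻¹ * (u * Real.exp (-(u * x) ^ 2 / 2)) := by
  rw [stdNormalCdf_sub_half, mul_comm a u]
  have := intervalIntegral.mul_integral_comp_mul_left (f := gaussianPDFReal 0 1) (a := 0) (b := a) u
  rw [mul_zero] at this
  rw [← this, ← intervalIntegral.integral_const_mul]
  congr 1
  ext x
  simp only [gaussianPDFReal]
  simp
  ring

lemma integral_Ioi_mul_exp_neg_mul_sq (h : ℝ) {b : ℝ} (hb : 0 < b) :
    ∫ u in Set.Ioi h, u * Real.exp (-b * u ^ 2) = Real.exp (-b * h ^ 2) / (2 * b) := by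
  have hd (u : ℝ) : HasDerivAt (fun u => -(Real.exp (-b * u ^ 2) / (2 * b)))
      (u * Real.exp (-b * u ^ 2)) u := by
    have h1 : HasDerivAt (fun u : ℝ => -b * u ^ 2) (-b * (2 * u)) u := by
      simpa using (hasDerivAt_pow 2 u).const_mul (-b)
    convert! (h1.exp.div_const (2 * b)).neg using 1
    field_simp
  rw [integral_Ioi_of_hasDerivAt_of_tendsto (m := 0) (hd h).continuousAt.continuousWithinAt
    (fun u _ => hd u) (integrable_mul_exp_neg_mul_sq hb).integrableOn]
  · ring
  · have h2 : Filter.Tendsto (fun u : ℝ => -b * u ^ 2) Filter.atTop Filter.atBot :=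
      (Filter.tendsto_pow_atTop two_ne_zero).const_mul_atTop_of_neg (by linarith)
    simpa using ((Real.tendsto_exp_atBot.comp h2).div_const (2 * b)).neg

/-- The probabilistic form of `T` on which all later computations rest. After exchanging the
integrals, the one over `u` is elementary, the integrand `u * exp(-(1 + x²) u² / 2)` having an
explicit antiderivative. -/
lemma owenT_eq_setIntegral (h a : ℝ) :
    owenT h a = ∫ u in Set.Ioi h, (stdNormalCdf (a * u) - 1 / 2) ∂(gaussianReal 0 1) := by
  have hπ : 0 < 2 * Real.pi := by positivity
  have e1 : ∫ u in Set.Ioi h, (stdNormalCdf (a * u) - 1 / 2) ∂(gaussianReal 0 1) =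
      ∫ u in Set.Ioi h, ∫ x in (0 : ℝ)..a,
        (2 * Real.pi)⁻¹ * (u * Real.exp (-((1 + x ^ 2) / 2) * u ^ 2)) := by
    rw [← integral_indicator measurableSet_Ioi, integral_gaussianReal_eq_integral_smul (by simp),
      ← integral_indicator measurableSet_Ioi]
    congr 1
    ext u
    by_cases hu : u ∈ Set.Ioi h
    · rw [Set.indicator_of_mem hu, Set.indicator_of_mem hu, stdNormalCdf_mul_sub_half, smul_eq_mul,
        ← intervalIntegral.integral_const_mul]
      congr 1
      ext x
      have e : -((1 + x ^ 2) / 2) * u ^ 2 = -u ^ 2 / 2 + -(u * x) ^ 2 / 2 := by ring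
      have e' : (2 * Real.pi)⁻¹ = (√(2 * Real.pi))⁻¹ * (√(2 * Real.pi))⁻¹ := by
        rw [← mul_inv, Real.mul_self_sqrt hπ.le]
      rw [e, Real.exp_add, e']
      simp only [gaussianPDFReal]
      simp
      ring
    · rw [Set.indicator_of_notMem hu, Set.indicator_of_notMem hu, smul_zero]
  -- General endpoints are needed because `a` may be negative: the oriented integral is the
  -- difference of those over `Ioc 0 a` and `Ioc a 0`.
  have hint (a b : ℝ) : Integrable (Function.uncurry fun u x : ℝ =>
      (2 * Real.pi)⁻¹ * (u * Real.exp (-((1 + x ^ 2) / 2) * u ^ 2)))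
      ((volume.restrict (Set.Ioi h)).prod (volume.restrict (Set.Ioc a b))) := by
    have hb : Integrable (fun u : ℝ => (2 * Real.pi)⁻¹ * (u * Real.exp (-(1 / 2) * u ^ 2)))
        (volume.restrict (Set.Ioi h)) :=
      ((integrable_mul_exp_neg_mul_sq (by norm_num)).const_mul _).integrableOn
    refine (hb.comp_fst (volume.restrict (Set.Ioc a b))).mono (by fun_prop) (.of_forall ?_)
    rintro ⟨u, x⟩
    simp only [Function.uncurry, norm_mul, Real.norm_eq_abs, Real.abs_exp]
    gcongr
    nlinarith [sq_nonneg (u * x), sq_nonneg x]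
  rw [e1, owenT, ← intervalIntegral.integral_const_mul]
  simp only [intervalIntegral]
  rw [integral_sub, integral_integral_swap (hint 0 a), integral_integral_swap (hint a 0)]
  rotate_left
  · exact (hint 0 a).integral_prod_left
  · exact (hint a 0).integral_prod_left
  congr! 3 with x x <;>
  · rw [integral_const_mul, integral_Ioi_mul_exp_neg_mul_sq h (by positivity)]
    congr 1
    congr 1
    · congr 1
      ring
    · ring

lemma abs_stdNormalCdf_le_one (x : ℝ) : |stdNormalCdf x| ≤ 1 :=
  abs_le.2 ⟨by linarith [stdNormalCdf_nonneg x], stdNormalCdf_le_one x⟩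

lemma abs_sign_le_one (x : ℝ) : |Real.sign x| ≤ 1 := by
  rcases Real.sign_apply_eq x with h | h | h <;> simp [h]

@[fun_prop]
lemma measurable_sign : Measurable Real.sign := by
  unfold Real.sign
  exact Measurable.ite measurableSet_Iio measurable_const
    (Measurable.ite measurableSet_Ioi measurable_const measurable_const)

lemma integrable_of_abs_le {α : Type*} [MeasurableSpace α] {μ : Measure α} [IsFiniteMeasure μ]
    {F : α → ℝ} (hF : Measurable F) (C : ℝ) (hC : ∀ p, |F p| ≤ C) : Integrable F μ :=
  Integrable.of_bound hF.aestronglyMeasurable C (.of_forall hC)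

lemma integral_sign_sub (x : ℝ) :
    ∫ y, Real.sign (x - y) ∂(gaussianReal 0 1) = 2 * stdNormalCdf x - 1 := by
  have hna : NullSingletonClass (gaussianReal 0 1) := nullSingletonClass_gaussianReal (by simp)
  have hi : Integrable ((Set.Iic x).indicator (1 : ℝ → ℝ)) (gaussianReal 0 1) :=
    (integrable_const 1).indicator measurableSet_Iic
  have : ∀ᵐ y ∂(gaussianReal 0 1), Real.sign (x - y) = 2 * (Set.Iic x).indicator 1 y - 1 := by
    have : ∀ᵐ y ∂(gaussianReal 0 1), y ≠ x := by simp [ae_iff]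
    filter_upwards [this] with y hy
    rcases lt_or_gt_of_ne hy with h | h
    · rw [Real.sign_of_pos (by linarith), Set.indicator_of_mem (Set.mem_Iic.2 h.le)]
      norm_num
    · rw [Real.sign_of_neg (by linarith), Set.indicator_of_notMem (by simpa using h)]
      norm_num
  rw [integral_congr_ae this, integral_sub (hi.const_mul 2) (integrable_const 1),
    integral_const_mul, ← stdNormalCdf_eq_integral]
  simp

/-- Reading `Φ` as a probability gives the event `s Z + v Y ≤ c`. A reflection makes `X = (s Z + v
Y) / w` the first coordinate, with `Z = (s X + v Y') / w`. Averaging the sign over `Y'` leaves `1 -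
2 Φ(s X / v)` on `X ≤ c / w`, whose integral `owenT_eq_setIntegral` evaluates. -/
lemma integral_sign_mul_stdNormalCdf (c s : ℝ) {v : ℝ} (hv : 0 < v) :
    ∫ z, Real.sign (-z) * stdNormalCdf ((c - s * z) / v) ∂(gaussianReal 0 1) =
      2 * owenT (c / √(v ^ 2 + s ^ 2)) (s / v) := by
  set w := √(v ^ 2 + s ^ 2) with hw_def
  have hw : 0 < w := by positivity
  have hw2 : w ^ 2 = v ^ 2 + s ^ 2 := Real.sq_sqrt (by positivity)
  let F : ℝ × ℝ → ℝ := fun p =>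
    Real.sign (-(s / w * p.1 + v / w * p.2)) * (Set.Iic (c / w)).indicator 1 p.1
  have hind : Measurable ((Set.Iic (c / w)).indicator (1 : ℝ → ℝ)) :=
    measurable_one.indicator measurableSet_Iic
  have hF : Measurable F := by fun_prop
  have hFb (p) : |F p| ≤ 1 := by
    simp only [F, abs_mul]
    refine mul_le_one₀ (abs_sign_le_one _) (abs_nonneg _) ?_
    simp only [Set.indicator]
    split_ifs <;> simp
  have hmeas : Measurable fun u => 1 - 2 * stdNormalCdf (s / v * u) := by fun_prop
  have hint : Integrable (fun u => 1 - 2 * stdNormalCdf (s / v * u)) (gaussianReal 0 1) :=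
    integrable_of_abs_le hmeas 1 fun u => abs_le.2
      ⟨by linarith [stdNormalCdf_le_one (s / v * u)], by linarith [stdNormalCdf_nonneg (s / v * u)]⟩
  have hzero : ∫ u, (1 - 2 * stdNormalCdf (s / v * u)) ∂(gaussianReal 0 1) = 0 := by
    rw [integral_sub (integrable_const 1) (Integrable.const_mul
      (integrable_of_abs_le (by fun_prop) 1 fun u => abs_stdNormalCdf_le_one _) 2), integral_const_mul]
    have := integral_stdNormalCdf_affine 0 (-(s / v)) one_pos
    simp only [zero_sub, neg_mul, neg_neg, div_one, zero_div, stdNormalCdf_zero] at this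
    simp [this]
  calc ∫ z, Real.sign (-z) * stdNormalCdf ((c - s * z) / v) ∂(gaussianReal 0 1)
      = ∫ x, ∫ y, F (s / w * x + v / w * y, v / w * x - s / w * y) ∂(gaussianReal 0 1)
          ∂(gaussianReal 0 1) := by
        congr! 2 with x
        rw [stdNormalCdf_eq_integral, ← integral_const_mul]
        refine integral_congr_ae (.of_forall fun y => ?_)
        -- The reflection is an involution, so the sign factor becomes that of `-x`.
        have e1 : s / w * (s / w * x + v / w * y) + v / w * (v / w * x - s / w * y) = x := by
          field_simp
          rw [hw2]
          ring
        simp only [F, e1]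
        congr 1
        have e2 : s / w * x + v / w * y = (s * x + v * y) / w := by ring
        simp only [Set.indicator, Set.mem_Iic, e2, div_le_div_iff_of_pos_right hw, le_div_iff₀ hv]
        congr 1
        ext
        constructor <;> intro <;> linarith
    _ = ∫ x, ∫ y, F (x, y) ∂(gaussianReal 0 1) ∂(gaussianReal 0 1) := by
        refine integral_rotation_gaussianReal ?_ hF hFb
        rw [div_pow, div_pow, hw2, ← add_div, add_comm, div_self (by positivity)]
    _ = ∫ x in Set.Iic (c / w), (1 - 2 * stdNormalCdf (s / v * x)) ∂(gaussianReal 0 1) := by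
        rw [← integral_indicator measurableSet_Iic]
        congr! 2 with x
        simp only [F]
        rw [integral_mul_const]
        by_cases hx : x ∈ Set.Iic (c / w)
        · rw [Set.indicator_of_mem hx, Set.indicator_of_mem hx, Pi.one_apply, mul_one]
          have e (y : ℝ) : Real.sign (-(s / w * x + v / w * y)) =
              Real.sign (-(s / v * x) - y) := by
            have : -(s / w * x + v / w * y) = v / w * (-(s / v * x) - y) := by
              field_simp
              ring
            rw [this]
            have hvw : 0 < v / w := by positivity
            rcases lt_trichotomy (-(s / v * x) - y) 0 with h | h | h
            · rw [Real.sign_of_neg h, Real.sign_of_neg (mul_neg_of_pos_of_neg hvw h)]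
            · rw [h, mul_zero]
            · rw [Real.sign_of_pos h, Real.sign_of_pos (mul_pos hvw h)]
          simp_rw [e]
          rw [integral_sign_sub, stdNormalCdf_neg]
          ring
        · rw [Set.indicator_of_notMem hx, Set.indicator_of_notMem hx, mul_zero]
    -- The integrand has mean zero over the whole line, so the lower tail is minus the upper one.
    _ = -∫ x in Set.Ioi (c / w), (1 - 2 * stdNormalCdf (s / v * x)) ∂(gaussianReal 0 1) := by
        have := integral_add_compl (measurableSet_Iic (a := c / w)) hint
        rw [hzero, Set.compl_Iic] at this
        linarith
    _ = _ := by
        rw [owenT_eq_setIntegral, ← integral_neg, ← integral_const_mul]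
        congr! 2 with x
        ring

/-- The mean absolute deviation of `Φ((c - t Y - s Z) / v)` around `Φ((c - t Y) / v)`. -/
lemma integral_abs_stdNormalCdf_sub (c t : ℝ) {s v : ℝ} (hs : 0 ≤ s) (hv : 0 < v) :
    ∫ y, ∫ z, |stdNormalCdf ((c - t * y - s * z) / v) - stdNormalCdf ((c - t * y) / v)|
      ∂(gaussianReal 0 1) ∂(gaussianReal 0 1) =
      2 * owenT (c / √(v ^ 2 + t ^ 2 + s ^ 2)) (s / √(v ^ 2 + t ^ 2)) := by
  have hsgn : ∫ z, Real.sign (-z) ∂(gaussianReal 0 1) = 0 := by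
    simpa [stdNormalCdf_zero] using integral_sign_sub 0
  have h1 (y : ℝ) :
      ∫ z, |stdNormalCdf ((c - t * y - s * z) / v) - stdNormalCdf ((c - t * y) / v)|
        ∂(gaussianReal 0 1) =
      ∫ z, Real.sign (-z) * stdNormalCdf ((c - t * y - s * z) / v) ∂(gaussianReal 0 1) := by
    -- Since `s ≥ 0` and `Φ` is monotone, the difference has the sign of `-z`. Its second term then
    -- drops out, being constant in `z` times a sign of mean zero.
    have e (z : ℝ) : |stdNormalCdf ((c - t * y - s * z) / v) - stdNormalCdf ((c - t * y) / v)| =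
        Real.sign (-z) * stdNormalCdf ((c - t * y - s * z) / v) -
          Real.sign (-z) * stdNormalCdf ((c - t * y) / v) := by
      rcases lt_trichotomy z 0 with h | h | h
      · rw [Real.sign_of_pos (by linarith), abs_of_nonneg]
        · ring
        · rw [sub_nonneg]
          refine monotone_stdNormalCdf (div_le_div_of_nonneg_right ?_ hv.le)
          nlinarith
      · simp [h]
      · rw [Real.sign_of_neg (by linarith), abs_of_nonpos]
        · ring
        · rw [sub_nonpos]
          refine monotone_stdNormalCdf (div_le_div_of_nonneg_right ?_ hv.le)
          nlinarith
    simp_rw [e]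
    rw [integral_sub, integral_mul_const, hsgn, zero_mul, sub_zero]
    · refine integrable_of_abs_le (by fun_prop) 1 fun z => ?_
      rw [abs_mul]
      exact mul_le_one₀ (abs_sign_le_one _) (abs_nonneg _) (abs_stdNormalCdf_le_one _)
    · exact (integrable_of_abs_le (by fun_prop) 1 fun z => abs_sign_le_one _).mul_const _
  simp_rw [h1]
  rw [integral_integral_swap]
  -- Integrating over `y` first only widens the scale `v` to `√(v² + t²)`.
  · have h2 (z : ℝ) : ∫ y, Real.sign (-z) * stdNormalCdf ((c - t * y - s * z) / v)
        ∂(gaussianReal 0 1) = Real.sign (-z) * stdNormalCdf ((c - s * z) / √(v ^ 2 + t ^ 2)) := by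
      rw [integral_const_mul, ← integral_stdNormalCdf_affine _ t hv]
      congr! 5 with y
      ring
    simp_rw [h2]
    rw [integral_sign_mul_stdNormalCdf c s (by positivity), Real.sq_sqrt (by positivity)]
  · refine integrable_of_abs_le (by unfold Function.uncurry; fun_prop) 1 fun z => ?_
    simp only [Function.uncurry]
    rw [abs_mul]
    exact mul_le_one₀ (abs_sign_le_one _) (abs_nonneg _) (abs_stdNormalCdf_le_one _)

/-- `Φ(x)²` is the mass of the quadrant where both coordinates are at most `x`. Turned by 45
degrees, this quadrant becomes the wedge `z + |y| ≤ √2 x`. The gain is that `Φ` now occurs linearly.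
-/
lemma stdNormalCdf_sq (x : ℝ) :
    stdNormalCdf x ^ 2 = ∫ y, stdNormalCdf (√2 * x - |y|) ∂(gaussianReal 0 1) := by
  let F : ℝ × ℝ → ℝ := fun p => (Set.Iic x).indicator 1 p.1 * (Set.Iic x).indicator 1 p.2
  have hind : Measurable ((Set.Iic x).indicator (1 : ℝ → ℝ)) :=
    measurable_one.indicator measurableSet_Iic
  have hF : Measurable F := by fun_prop
  have hFb (p) : |F p| ≤ 1 := by
    simp only [F, Set.indicator]
    split_ifs <;> simp
  have h2 : (√2 : ℝ) ^ 2 = 2 := Real.sq_sqrt (by norm_num)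
  have hp : 0 < √2 := by positivity
  have hrot := integral_rotation_gaussianReal (α := 1 / √2) (β := 1 / √2)
    (by rw [div_pow, h2]; norm_num) hF hFb
  have e1 : ∫ p, ∫ y, F (p, y) ∂(gaussianReal 0 1) ∂(gaussianReal 0 1) = stdNormalCdf x ^ 2 := by
    simp only [F]
    simp_rw [integral_const_mul, integral_mul_const, ← stdNormalCdf_eq_integral]
    ring
  rw [← e1, ← hrot, integral_integral_swap]
  · congr 1
    ext y
    rw [stdNormalCdf_eq_integral]
    congr 1
    ext z
    have : z ≤ √2 * x - |y| ↔ 1 / √2 * z + 1 / √2 * y ≤ x ∧ 1 / √2 * z - 1 / √2 * y ≤ x := by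
      have a1 : 1 / √2 * z + 1 / √2 * y = (z + y) / √2 := by ring
      have a2 : 1 / √2 * z - 1 / √2 * y = (z - y) / √2 := by ring
      rw [a1, a2, div_le_iff₀ hp, div_le_iff₀ hp, le_sub_iff_add_le, ← le_sub_iff_add_le',
        abs_le']
      constructor
      · rintro ⟨h, h'⟩
        constructor <;> linarith
      · rintro ⟨h, h'⟩
        constructor <;> linarith
    simp only [F, Set.indicator, Set.mem_Iic, this, Pi.one_apply]
    rw [ite_and]
    split_ifs <;> simp
  · exact integrable_of_abs_le (by unfold Function.uncurry; fun_prop) 1 fun z => hFb _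

/-- After linearising with `stdNormalCdf_sq`, the average over `z` is an affine one with unit noise,
which rescales by `w`. What remains is an average over `|y|`, which splits into a plain average and
a sign-weighted one, both known. -/
lemma integral_stdNormalCdf_sq_affine (c s : ℝ) {v : ℝ} (hv : 0 < v) :
    ∫ z, stdNormalCdf ((c - s * z) / v) ^ 2 ∂(gaussianReal 0 1) =
      stdNormalCdf (c / √(v ^ 2 + s ^ 2)) -
        2 * owenT (c / √(v ^ 2 + s ^ 2)) (v / √(v ^ 2 + 2 * s ^ 2)) := by
  have h2 : (√2 : ℝ) ^ 2 = 2 := Real.sq_sqrt (by norm_num)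
  have hp : 0 < √2 := by positivity
  set c' := √2 * c / v
  set w := √(1 ^ 2 + (√2 * s / v) ^ 2) with hw_def
  have hw : 0 < w := by positivity
  have hw2 : w ^ 2 = 1 + 2 * s ^ 2 / v ^ 2 := by
    rw [Real.sq_sqrt (by positivity), div_pow, mul_pow, h2]
    norm_num
  let G : ℝ → ℝ := fun y => stdNormalCdf ((c' - y) / w)
  have hG : Measurable G := by fun_prop
  have hGi : Integrable G (gaussianReal 0 1) :=
    integrable_of_abs_le hG 1 fun _ => abs_stdNormalCdf_le_one _
  have hGs : Integrable (fun y => Real.sign (-y) * G y) (gaussianReal 0 1) := by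
    refine integrable_of_abs_le (by fun_prop) 1 fun z => ?_
    rw [abs_mul]
    exact mul_le_one₀ (abs_sign_le_one _) (abs_nonneg _) (abs_stdNormalCdf_le_one _)
  have habs : ∫ y, G |y| ∂(gaussianReal 0 1) =
      ∫ y, G y ∂(gaussianReal 0 1) - ∫ y, Real.sign (-y) * G y ∂(gaussianReal 0 1) := by
    -- The factor `1 - sign (-y)` is `2` for `y > 0` and `0` for `y < 0`; symmetrising in `y`
    -- recovers `G |y|`.
    have e (y : ℝ) : G |y| = (1 / 2) * ((G y - Real.sign (-y) * G y) +
        (G (-y) - Real.sign (- -y) * G (-y))) := by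
      rcases lt_trichotomy y 0 with h | h | h
      · rw [abs_of_neg h, Real.sign_of_pos (by linarith), Real.sign_of_neg (by linarith)]
        ring
      · simp [h]
        ring
      · rw [abs_of_pos h, Real.sign_of_neg (by linarith), Real.sign_of_pos (by linarith)]
        ring
    have hneg : Integrable (fun y => G (-y) - Real.sign (- -y) * G (-y)) (gaussianReal 0 1) := by
      refine (integrable_of_abs_le (by fun_prop) 1 fun _ => abs_stdNormalCdf_le_one _).sub
        (integrable_of_abs_le (by fun_prop) 1 fun z => ?_)
      rw [abs_mul]
      exact mul_le_one₀ (abs_sign_le_one _) (abs_nonneg _) (abs_stdNormalCdf_le_one _)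
    simp_rw [e]
    rw [integral_const_mul,
      integral_add (f := fun y => G y - Real.sign (-y) * G y) (hGi.sub hGs) hneg,
      integral_gaussianReal_comp_neg (fun y => G y - Real.sign (-y) * G y),
      integral_sub hGi hGs]
    ring
  calc ∫ z, stdNormalCdf ((c - s * z) / v) ^ 2 ∂(gaussianReal 0 1)
      = ∫ z, ∫ y, stdNormalCdf ((c' - |y| - √2 * s / v * z) / 1) ∂(gaussianReal 0 1)
          ∂(gaussianReal 0 1) := by
        simp_rw [stdNormalCdf_sq]
        congr! 5 with z y
        simp only [c']
        field_simp
        ring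
    _ = ∫ y, G |y| ∂(gaussianReal 0 1) := by
        rw [integral_integral_swap]
        · simp_rw [integral_stdNormalCdf_affine _ _ one_pos]
          rfl
        · exact integrable_of_abs_le (by unfold Function.uncurry; fun_prop) 1
            fun z => abs_stdNormalCdf_le_one _
    _ = stdNormalCdf (c' / √(w ^ 2 + 1 ^ 2)) -
          2 * owenT (c' / √(w ^ 2 + 1 ^ 2)) (1 / w) := by
        rw [habs, ← integral_stdNormalCdf_affine c' 1 hw,
          ← integral_sign_mul_stdNormalCdf c' 1 hw]
        simp only [one_mul, G]
    _ = _ := by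
        have e1 : w ^ 2 + 1 ^ 2 = 2 * (v ^ 2 + s ^ 2) / v ^ 2 := by
          rw [hw2]
          field_simp
          ring
        have e2 : w = √(v ^ 2 + 2 * s ^ 2) / v := by
          rw [hw_def, ← Real.sqrt_sq hv.le, ← Real.sqrt_div' _ (by positivity),
            Real.sqrt_sq hv.le]
          congr 1
          rw [div_pow, mul_pow, h2]
          field_simp
        have e3 : c' / √(w ^ 2 + 1 ^ 2) = c / √(v ^ 2 + s ^ 2) := by
          rw [e1, Real.sqrt_div' _ (by positivity), Real.sqrt_sq hv.le,
            Real.sqrt_mul (by norm_num)]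
          simp only [c']
          have : 0 < √(v ^ 2 + s ^ 2) := by positivity
          field_simp
        rw [e3, e2, one_div_div]

/-- The expected variance of `Φ((c - t Y - s Z) / v)` given `Y`. -/
lemma integral_variance_stdNormalCdf (c t s : ℝ) {v : ℝ} (hv : 0 < v) :
    ∫ y, (∫ z, stdNormalCdf ((c - t * y - s * z) / v) ^ 2 ∂(gaussianReal 0 1) -
      (∫ z, stdNormalCdf ((c - t * y - s * z) / v) ∂(gaussianReal 0 1)) ^ 2) ∂(gaussianReal 0 1) =
      2 * (owenT (c / √(v ^ 2 + s ^ 2 + t ^ 2))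
          (√(v ^ 2 + s ^ 2) / √(v ^ 2 + s ^ 2 + 2 * t ^ 2)) -
        owenT (c / √(v ^ 2 + s ^ 2 + t ^ 2)) (v / √(v ^ 2 + 2 * (s ^ 2 + t ^ 2)))) := by
  have hsq (x : ℝ) : |stdNormalCdf x ^ 2| ≤ 1 := by
    rw [abs_pow]
    exact pow_le_one₀ (abs_nonneg _) (abs_stdNormalCdf_le_one _)
  rw [integral_sub]
  -- The second moment sees only the combined variance `t² + s²`. The inner mean is again a `Φ`, of
  -- scale `√(v² + s²)`, so its square averages by the same lemma. The two `Φ` terms coincide and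
  -- cancel.
  · have e1 : ∫ y, ∫ z, stdNormalCdf ((c - t * y - s * z) / v) ^ 2 ∂(gaussianReal 0 1)
        ∂(gaussianReal 0 1) = _ :=
      (by simp_rw [sub_sub] : _ = ∫ y, ∫ z, (fun x => stdNormalCdf ((c - x) / v) ^ 2)
        (t * y + s * z) ∂(gaussianReal 0 1) ∂(gaussianReal 0 1)).trans
      (integral_gaussianReal_comp_add s t (F := fun x => stdNormalCdf ((c - x) / v) ^ 2)
        (by fun_prop) fun x => hsq _)
    rw [e1, integral_stdNormalCdf_sq_affine c _ hv]
    simp_rw [integral_stdNormalCdf_affine _ s hv]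
    rw [integral_stdNormalCdf_sq_affine c t (by positivity), Real.sq_sqrt (by positivity),
      Real.sq_sqrt (by positivity)]
    rw [show v ^ 2 + (t ^ 2 + s ^ 2) = v ^ 2 + s ^ 2 + t ^ 2 by ring, add_comm (t ^ 2) (s ^ 2)]
    ring
  · refine Integrable.integral_prod_left (μ := gaussianReal 0 1) (ν := gaussianReal 0 1)
      (f := fun p : ℝ × ℝ => stdNormalCdf ((c - t * p.1 - s * p.2) / v) ^ 2) ?_
    exact integrable_of_abs_le (by fun_prop) 1 fun x => hsq _
  · simp_rw [integral_stdNormalCdf_affine _ s hv]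
    exact integrable_of_abs_le (by fun_prop) 1 fun x => hsq _

/-- With the domain fixed and an integrand bounded by `1 / 2`, joint measurability in `(h, a)` and a
uniform bound on `T` follow. -/
lemma owenT_eq_integral_indicator (h a : ℝ) :
    owenT h a = ∫ u, (if h < u then stdNormalCdf (a * u) - 1 / 2 else 0) ∂(gaussianReal 0 1) := by
  rw [owenT_eq_setIntegral, ← integral_indicator measurableSet_Ioi]
  rfl

@[fun_prop]
lemma measurable_owenT : Measurable fun p : ℝ × ℝ => owenT p.1 p.2 := by
  simp_rw [owenT_eq_integral_indicator]
  have : Measurable fun q : (ℝ × ℝ) × ℝ =>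
      if q.1.1 < q.2 then stdNormalCdf (q.1.2 * q.2) - 1 / 2 else 0 :=
    Measurable.ite (measurableSet_lt (by fun_prop) (by fun_prop)) (by fun_prop) (by fun_prop)
  exact this.stronglyMeasurable.integral_prod_right.measurable

lemma measurable_owenT_comp {α : Type*} [MeasurableSpace α] {u v : α → ℝ} (hu : Measurable u)
    (hv : Measurable v) : Measurable fun x => owenT (u x) (v x) := by
  have := Measurable.comp (g := fun p : ℝ × ℝ => owenT p.1 p.2) measurable_owenT (hu.prodMk hv)
  exact this

lemma abs_owenT_le (h a : ℝ) : |owenT h a| ≤ 1 / 2 := by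
  rw [owenT_eq_integral_indicator]
  have hb : ∀ u : ℝ, ‖if h < u then stdNormalCdf (a * u) - 1 / 2 else 0‖ ≤ 1 / 2 := by
    intro u
    rw [Real.norm_eq_abs]
    split_ifs
    · exact abs_le.2 ⟨by linarith [stdNormalCdf_nonneg (a * u)],
        by linarith [stdNormalCdf_le_one (a * u)]⟩
    · simp
  simpa using norm_integral_le_of_norm_le_const (μ := gaussianReal 0 1) (.of_forall hb)

lemma owenT_mono_right (h : ℝ) {a a' : ℝ} (ha : a ≤ a') : owenT h a ≤ owenT h a' := by
  have hc : Continuous fun x : ℝ => Real.exp (-(h ^ 2 * (1 + x ^ 2)) / 2) / (1 + x ^ 2) :=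
    Continuous.div (by fun_prop) (by fun_prop) fun x => by positivity
  rw [owenT, owenT]
  refine mul_le_mul_of_nonneg_left ?_ (by positivity)
  rw [← intervalIntegral.integral_add_adjacent_intervals (hc.intervalIntegrable 0 a)
    (hc.intervalIntegrable a a')]
  linarith [intervalIntegral.integral_nonneg (μ := volume) ha fun x _ =>
    (by positivity : 0 ≤ Real.exp (-(h ^ 2 * (1 + x ^ 2)) / 2) / (1 + x ^ 2))]

lemma owenT_nonneg (h : ℝ) {a : ℝ} (ha : 0 ≤ a) : 0 ≤ owenT h a := by
  simpa [owenT] using owenT_mono_right h ha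

end Owen

/-! ### The algebra of the Gaussian process posterior -/

section Algebra

variable {p : ℕ} {Θ : Set (EuclideanSpace ℝ (Fin p))} {r : ℕ} (M : Model Θ r)

lemma IsCovarianceFunction.posSemidef {T : Type*} {k : T → T → ℝ} (hk : IsCovarianceFunction k)
    {ι : Type*} [Fintype ι] (x : ι → T) : (Matrix.of fun i j => k (x i) (x j)).PosSemidef := by
  have h := (hk _ (x ∘ (Fintype.equivFin ι).symm)).submatrix (Fintype.equivFin ι)
  convert h using 1
  ext i j
  simp

lemma IsCovarianceFunction.symm {T : Type*} {k : T → T → ℝ} (hk : IsCovarianceFunction k)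
    (s t : T) : k s t = k t s := by
  have h := (hk.posSemidef (fun b : Bool => if b then s else t)).isHermitian.apply false true
  simpa using h

/-- The marginal prior mean `h(θ)ᵀ b` of `f`. -/
def Model.priorMean (θ : Θ) : ℝ := (fun a => M.h a θ) ⬝ᵥ M.b

/-- The marginal prior covariance `k(θ, θ') + h(θ)ᵀ B h(θ')` of `f`. -/
def Model.priorCov (θ θ' : Θ) : ℝ := M.k θ θ' + (fun a => M.h a θ) ⬝ᵥ (M.B *ᵥ fun a => M.h a θ')

lemma Model.priorCov_gram {ι : Type*} (x : ι → Θ) :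
    (Matrix.of fun i j => M.priorCov (x i) (x j)) =
      (Matrix.of fun i j => M.k (x i) (x j)) +
        (M.basisMatrix x)ᵀ * M.B * M.basisMatrix x := by
  ext i j
  rw [Matrix.mul_assoc]
  simp [priorCov, basisMatrix, Matrix.mul_apply, dotProduct, Matrix.mulVec]

lemma Model.priorCov_isCovarianceFunction : IsCovarianceFunction M.priorCov := by
  intro n x
  rw [M.priorCov_gram]
  have := M.B_posDef.posSemidef.conjTranspose_mul_mul_same (M.basisMatrix x)
  rw [conjTranspose_eq_transpose_of_trivial] at this
  exact (M.k_covariance n x).add this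

variable {ι : Type*} [Fintype ι] [DecidableEq ι]

lemma posDef_noise {κ : Type*} [Fintype κ] [DecidableEq κ] :
    (M.σ ^ 2 • (1 : Matrix κ κ ℝ)).PosDef :=
  PosDef.one.smul (pow_pos M.σ_pos 2)

omit [Fintype ι] in
lemma Model.gram_eq (x : ι → Θ) :
    M.gram x = (Matrix.of fun i j => M.k (x i) (x j)) + M.σ ^ 2 • (1 : Matrix ι ι ℝ) := by
  ext i j
  simp [gram, Matrix.one_apply]

lemma Model.gram_posDef (x : ι → Θ) : (M.gram x).PosDef := by
  rw [M.gram_eq]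
  exact PosDef.posSemidef_add (M.k_covariance.posSemidef x) (posDef_noise M)

lemma Model.precision_posDef (x : ι → Θ) : (M.precision x).PosDef := by
  have h := (M.gram_posDef x).inv.posSemidef.mul_mul_conjTranspose_same (M.basisMatrix x)
  rw [conjTranspose_eq_transpose_of_trivial] at h
  exact M.B_posDef.inv.add_posSemidef h

/-- The covariance matrix of the observations at `x`. -/
def Model.obsCov (x : ι → Θ) : Matrix ι ι ℝ :=
  (Matrix.of fun i j => M.priorCov (x i) (x j)) + M.σ ^ 2 • (1 : Matrix ι ι ℝ)

lemma Model.obsCov_posDef (x : ι → Θ) : (M.obsCov x).PosDef :=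
  PosDef.posSemidef_add (M.priorCov_isCovarianceFunction.posSemidef x) (posDef_noise M)

omit [Fintype ι] in
lemma Model.obsCov_eq (x : ι → Θ) :
    M.obsCov x = M.gram x + (M.basisMatrix x)ᵀ * M.B * M.basisMatrix x := by
  rw [obsCov, M.priorCov_gram, M.gram_eq]
  abel

/-- The kriging weights of the observations at `x` for the prediction of `f θ`. -/
def Model.weights (x : ι → Θ) (θ : Θ) : ι → ℝ :=
  (M.gram x)⁻¹ *ᵥ (M.kvec x θ + (M.basisMatrix x)ᵀ *ᵥ ((M.precision x)⁻¹ *ᵥ M.resid x θ))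

lemma Model.gram_mulVec_weights (x : ι → Θ) (θ : Θ) :
    M.gram x *ᵥ M.weights x θ =
      M.kvec x θ + (M.basisMatrix x)ᵀ *ᵥ ((M.precision x)⁻¹ *ᵥ M.resid x θ) := by
  rw [weights, mulVec_mulVec, mul_nonsing_inv _ ((M.gram_posDef x).isUnit.map detMonoidHom),
    one_mulVec]

/-- From `G = B⁻¹ + H K⁻¹ Hᵀ` one gets `H K⁻¹ Hᵀ G⁻¹ R = R - B⁻¹ G⁻¹ R`, while `H K⁻¹ k = h - R` by
definition of `R`; the two occurrences of `R` cancel. -/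
lemma Model.basisMatrix_mulVec_weights (x : ι → Θ) (θ : Θ) :
    M.basisMatrix x *ᵥ M.weights x θ =
      (fun a => M.h a θ) - M.B⁻¹ *ᵥ ((M.precision x)⁻¹ *ᵥ M.resid x θ) := by
  have h1 : M.precision x *ᵥ ((M.precision x)⁻¹ *ᵥ M.resid x θ) = M.resid x θ := by
    rw [mulVec_mulVec, mul_nonsing_inv _ ((M.precision_posDef x).isUnit.map detMonoidHom),
      one_mulVec]
  have h2 : (M.basisMatrix x * (M.gram x)⁻¹ * (M.basisMatrix x)ᵀ) *ᵥ
      ((M.precision x)⁻¹ *ᵥ M.resid x θ) =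
      M.resid x θ - M.B⁻¹ *ᵥ ((M.precision x)⁻¹ *ᵥ M.resid x θ) := by
    conv_rhs => enter [1]; rw [← h1]
    conv_rhs => enter [1, 1]; rw [precision]
    rw [add_mulVec]
    abel
  rw [weights, mulVec_add, mulVec_add, mulVec_mulVec _ (M.gram x)⁻¹ (M.basisMatrix x)ᵀ,
    mulVec_mulVec _ (M.basisMatrix x) ((M.gram x)⁻¹ * _), ← Matrix.mul_assoc, h2]
  conv_lhs => enter [2, 1]; rw [resid]
  abel

/-- The normal equations of the GP with `γ` integrated out. This takes the place of the Woodbury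
identity: the contributions `Hᵀ G⁻¹ R` from `K` and from `Hᵀ B H` cancel. -/
lemma Model.obsCov_mulVec_weights (x : ι → Θ) (θ : Θ) :
    M.obsCov x *ᵥ M.weights x θ = fun i => M.priorCov θ (x i) := by
  rw [M.obsCov_eq, add_mulVec, M.gram_mulVec_weights, ← mulVec_mulVec,
    M.basisMatrix_mulVec_weights, mulVec_sub, ← mulVec_mulVec, ← mulVec_mulVec,
    mulVec_mulVec _ M.B, mul_nonsing_inv _ (M.B_posDef.isUnit.map detMonoidHom), one_mulVec,
    add_add_sub_cancel]
  ext i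
  rw [M.priorCov_isCovarianceFunction.symm]
  simp only [priorCov, Pi.add_apply, kvec]
  rw [M.k_covariance.symm]
  rfl

lemma Model.eq_weights (x : ι → Θ) (θ : Θ) {u : ι → ℝ}
    (hu : M.obsCov x *ᵥ u = fun i => M.priorCov θ (x i)) : u = M.weights x θ := by
  refine mulVec_injective_of_isUnit (M.obsCov_posDef x).isUnit ?_
  rw [hu, M.obsCov_mulVec_weights]

lemma Model.gram_inv_transpose (x : ι → Θ) : ((M.gram x)⁻¹)ᵀ = (M.gram x)⁻¹ := by
  rw [← conjTranspose_eq_transpose_of_trivial]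
  exact (M.gram_posDef x).inv.isHermitian

lemma Model.precision_inv_transpose (x : ι → Θ) : ((M.precision x)⁻¹)ᵀ = (M.precision x)⁻¹ := by
  rw [← conjTranspose_eq_transpose_of_trivial]
  exact (M.precision_posDef x).inv.isHermitian

lemma dotProduct_mulVec_of_symm {κ : Type*} [Fintype κ] {A : Matrix κ κ ℝ} (hA : Aᵀ = A)
    (u v : κ → ℝ) : u ⬝ᵥ (A *ᵥ v) = (A *ᵥ u) ⬝ᵥ v := by
  rw [dotProduct_mulVec, ← mulVec_transpose, hA]

lemma transpose_mulVec_dotProduct {κ κ' : Type*} [Fintype κ] [Fintype κ'] (A : Matrix κ κ' ℝ)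
    (u : κ → ℝ) (v : κ' → ℝ) : (Aᵀ *ᵥ u) ⬝ᵥ v = u ⬝ᵥ (A *ᵥ v) := by
  rw [mulVec_transpose, ← dotProduct_mulVec]

lemma Model.weights_dotProduct (x : ι → Θ) (θ : Θ) (u : ι → ℝ) :
    M.weights x θ ⬝ᵥ u = M.kvec x θ ⬝ᵥ ((M.gram x)⁻¹ *ᵥ u) +
      M.resid x θ ⬝ᵥ ((M.precision x)⁻¹ *ᵥ (M.basisMatrix x *ᵥ ((M.gram x)⁻¹ *ᵥ u))) := by
  rw [weights, ← dotProduct_mulVec_of_symm (M.gram_inv_transpose x), add_dotProduct,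
    dotProduct_mulVec_of_symm (M.precision_inv_transpose x), transpose_mulVec_dotProduct]

lemma Model.weights_dotProduct_basis (x : ι → Θ) (θ : Θ) (u : Fin r → ℝ) :
    M.weights x θ ⬝ᵥ ((M.basisMatrix x)ᵀ *ᵥ u) = (fun a => M.h a θ) ⬝ᵥ u -
      M.resid x θ ⬝ᵥ ((M.precision x)⁻¹ *ᵥ (M.B⁻¹ *ᵥ u)) := by
  have h2 : M.B⁻¹ᵀ = M.B⁻¹ := by
    rw [← conjTranspose_eq_transpose_of_trivial]
    exact M.B_posDef.inv.isHermitian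
  rw [dotProduct_comm, transpose_mulVec_dotProduct, M.basisMatrix_mulVec_weights, dotProduct_sub,
    dotProduct_comm, dotProduct_mulVec_of_symm h2, dotProduct_comm (M.B⁻¹ *ᵥ u),
    dotProduct_mulVec_of_symm (M.precision_inv_transpose x)]

/-- With `postCov_eq`, this identifies the posterior as plain Gaussian conditioning of the marginal
prior, a form that behaves well under merging of data. -/
lemma Model.postMean_eq (D : Data Θ ι) (θ : Θ) :
    M.postMean D θ = M.priorMean θ +
      M.weights D.loc θ ⬝ᵥ (D.val - fun i => M.priorMean (D.loc i)) := by
  have h1 : (fun i => M.priorMean (D.loc i)) = (M.basisMatrix D.loc)ᵀ *ᵥ M.b := rfl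
  rw [dotProduct_sub, h1, M.weights_dotProduct_basis, M.weights_dotProduct, postMean, gammaBar,
    mulVec_add, dotProduct_add, priorMean]
  ring

lemma Model.postCov_eq (x : ι → Θ) (θ θ' : Θ) :
    M.postCov x θ θ' = M.priorCov θ θ' - M.weights x θ ⬝ᵥ fun i => M.priorCov θ' (x i) := by
  have h1 : (fun i => M.priorCov θ' (x i)) =
      M.kvec x θ' + (M.basisMatrix x)ᵀ *ᵥ (M.B *ᵥ fun a => M.h a θ') := by
    ext i
    rw [M.priorCov_isCovarianceFunction.symm]
    simp only [priorCov, Pi.add_apply, kvec]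
    rw [M.k_covariance.symm]
    rfl
  have h2 : M.basisMatrix x *ᵥ ((M.gram x)⁻¹ *ᵥ M.kvec x θ') =
      (fun a => M.h a θ') - M.resid x θ' := by
    rw [resid]
    abel
  rw [h1, dotProduct_add, M.weights_dotProduct, M.weights_dotProduct_basis, h2, mulVec_sub,
    dotProduct_sub, mulVec_mulVec _ M.B⁻¹,
    nonsing_inv_mul _ (M.B_posDef.isUnit.map detMonoidHom), one_mulVec, postCov, priorCov]
  ring

lemma Model.postCov_symm (x : ι → Θ) (θ θ' : Θ) : M.postCov x θ θ' = M.postCov x θ' θ := by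
  have h : (M.obsCov x)ᵀ = M.obsCov x := by
    rw [← conjTranspose_eq_transpose_of_trivial]
    exact (M.obsCov_posDef x).isHermitian
  rw [M.postCov_eq, M.postCov_eq, M.priorCov_isCovarianceFunction.symm θ θ',
    ← M.obsCov_mulVec_weights, ← M.obsCov_mulVec_weights, dotProduct_mulVec_of_symm h,
    dotProduct_comm]

/-- The matrix is the Schur complement of `obsCov x` in the joint covariance of the noisy
observations at `x` and the noiseless values at `xs`. -/
lemma Model.postCovMatrix_posSemidef (x : ι → Θ) {q : ℕ} (xs : Fin q → Θ) :
    (M.postCovMatrix x xs).PosSemidef := by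
  have : Invertible (M.obsCov x) := (M.obsCov_posDef x).isUnit.invertible
  set A : Matrix ι (Fin q) ℝ := Matrix.of fun i j => M.priorCov (xs j) (x i) with hA
  have hC : M.postCovMatrix x xs =
      (Matrix.of fun i j => M.priorCov (xs i) (xs j)) - Aᴴ * (M.obsCov x)⁻¹ * A := by
    have hw (j) : M.weights x (xs j) = (M.obsCov x)⁻¹ *ᵥ fun i => M.priorCov (xs j) (x i) := by
      rw [← M.obsCov_mulVec_weights, mulVec_mulVec,
        nonsing_inv_mul _ ((M.obsCov_posDef x).isUnit.map detMonoidHom), one_mulVec]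
    ext i j
    rw [postCovMatrix, of_apply, M.postCov_symm, M.postCov_eq, hw, dotProduct_comm,
      M.priorCov_isCovarianceFunction.symm, Matrix.mul_assoc]
    rfl
  rw [hC, ← PosDef.fromBlocks₁₁ _ _ (M.obsCov_posDef x)]
  have hk := M.priorCov_isCovarianceFunction.posSemidef (Sum.elim x xs)
  have hd : (Matrix.diagonal (Sum.elim (fun _ : ι => M.σ ^ 2) fun _ : Fin q => 0)).PosSemidef := by
    refine PosSemidef.diagonal fun i => ?_
    rcases i with i | i
    · exact sq_nonneg M.σ
    · exact le_rfl
  have e : fromBlocks (M.obsCov x) A Aᴴ (Matrix.of fun i j => M.priorCov (xs i) (xs j)) =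
      (Matrix.of fun i j => M.priorCov (Sum.elim x xs i) (Sum.elim x xs j)) +
        Matrix.diagonal (Sum.elim (fun _ : ι => M.σ ^ 2) fun _ : Fin q => 0) := by
    ext (i | i) (j | j)
    · simp [obsCov, Matrix.diagonal_apply, Matrix.one_apply]
    · simp [hA, M.priorCov_isCovarianceFunction.symm (x i)]
    · simp [hA]
    · simp [Matrix.diagonal_apply]
  rw [e]
  exact hk.add hd

/-! ### Updating the posterior by a batch of new observations -/

variable {q : ℕ} (xs : Fin q → Θ)

/-- The matrix `c(θ*, θ*) + σ² I`, the predictive covariance of the future discrepancies. -/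
def Model.predCov (x : ι → Θ) : Matrix (Fin q) (Fin q) ℝ :=
  M.postCovMatrix x xs + M.σ ^ 2 • (1 : Matrix (Fin q) (Fin q) ℝ)

lemma Model.predCov_posDef (x : ι → Θ) : (M.predCov xs x).PosDef :=
  PosDef.posSemidef_add (M.postCovMatrix_posSemidef x xs) (posDef_noise M)

/-- The gain `[c(θ*, θ*) + σ² I]⁻¹ c(θ*, θ)`. -/
def Model.gain (x : ι → Θ) (θ : Θ) : Fin q → ℝ :=
  (M.predCov xs x)⁻¹ *ᵥ fun i => M.postCov x (xs i) θ

lemma Model.predCov_mulVec_gain (x : ι → Θ) (θ : Θ) :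
    M.predCov xs x *ᵥ M.gain xs x θ = fun i => M.postCov x (xs i) θ := by
  rw [gain, mulVec_mulVec, mul_nonsing_inv _ ((M.predCov_posDef xs x).isUnit.map detMonoidHom),
    one_mulVec]

lemma Model.tauSq_eq (x : ι → Θ) (θ : Θ) :
    M.tauSq x xs θ = M.gain xs x θ ⬝ᵥ fun i => M.postCov x (xs i) θ := by
  rw [dotProduct_comm, tauSq, gain, predCov]
  simp_rw [M.postCov_symm x θ]

lemma Model.tauSq_eq_quadratic (x : ι → Θ) (θ : Θ) :
    M.tauSq x xs θ = M.gain xs x θ ⬝ᵥ (M.predCov xs x *ᵥ M.gain xs x θ) := by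
  rw [M.tauSq_eq, M.predCov_mulVec_gain]

lemma Model.tauSq_nonneg (x : ι → Θ) (θ : Θ) : 0 ≤ M.tauSq x xs θ := by
  rw [M.tauSq_eq_quadratic]
  simpa using (M.predCov_posDef xs x).posSemidef.dotProduct_mulVec_nonneg (M.gain xs x θ)

/-- New observations enter through their innovations, with coefficients given by the gain;
subtracting their predictions from `x` corrects the old weights. By uniqueness it is enough to check
the normal equations block by block. -/
lemma Model.weights_union (x : ι → Θ) (θ : Θ) :
    M.weights (Sum.elim x xs) θ =
      Sum.elim (M.weights x θ - ∑ j, M.gain xs x θ j • M.weights x (xs j)) (M.gain xs x θ) := by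
  symm
  apply M.eq_weights
  have hblock : M.obsCov (Sum.elim x xs) =
      fromBlocks (M.obsCov x) (Matrix.of fun i j => M.priorCov (x i) (xs j))
        (Matrix.of fun i j => M.priorCov (xs i) (x j)) (M.obsCov xs) := by
    ext (i | i) (j | j) <;> simp [obsCov, Matrix.one_apply]
  rw [hblock, fromBlocks_mulVec]
  simp only [Sum.elim_comp_inl, Sum.elim_comp_inr]
  ext (i | i)
  · simp only [Sum.elim_inl, Pi.add_apply]
    rw [mulVec_sub, mulVec_sum, M.obsCov_mulVec_weights]
    simp_rw [mulVec_smul, M.obsCov_mulVec_weights]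
    simp only [Pi.sub_apply, Finset.sum_apply, Pi.smul_apply, smul_eq_mul, mulVec, dotProduct,
      of_apply]
    simp_rw [M.priorCov_isCovarianceFunction.symm (x i), mul_comm (M.gain xs x θ _)]
    ring
  -- `predCov` is the Schur complement of the old block, so the lower block row is the equation
  -- defining the gain.
  · have h := congrFun (M.predCov_mulVec_gain xs x θ) i
    have hc (j) : M.predCov xs x i j = M.obsCov xs i j -
        ∑ l, M.priorCov (xs i) (x l) * M.weights x (xs j) l := by
      simp only [predCov, obsCov, Matrix.add_apply, postCovMatrix, of_apply]
      rw [M.postCov_symm, M.postCov_eq, M.priorCov_isCovarianceFunction.symm, dotProduct_comm,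
        dotProduct]
      ring
    rw [M.postCov_symm, M.postCov_eq] at h
    simp only [mulVec, dotProduct, hc, sub_mul, Finset.sum_sub_distrib] at h
    simp only [Sum.elim_inr, Pi.add_apply, mulVec, dotProduct, of_apply, Pi.sub_apply,
      Finset.sum_apply, Pi.smul_apply, smul_eq_mul, mul_sub, Finset.sum_sub_distrib]
    have h3 : ∑ l, M.priorCov (xs i) (x l) * ∑ j, M.gain xs x θ j * M.weights x (xs j) l =
        ∑ j, (∑ l, M.priorCov (xs i) (x l) * M.weights x (xs j) l) * M.gain xs x θ j := by
      simp_rw [Finset.mul_sum, Finset.sum_mul]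
      rw [Finset.sum_comm]
      refine Finset.sum_congr rfl fun j _ => Finset.sum_congr rfl fun l _ => ?_
      ring
    rw [h3]
    simp_rw [mul_comm (M.weights x θ _)] at h
    linarith

lemma Model.weights_union_dotProduct (x : ι → Θ) (θ : Θ) (u : ι → ℝ) (v : Fin q → ℝ) :
    M.weights (Sum.elim x xs) θ ⬝ᵥ Sum.elim u v = M.weights x θ ⬝ᵥ u +
      M.gain xs x θ ⬝ᵥ (v - fun j => M.weights x (xs j) ⬝ᵥ u) := by
  rw [M.weights_union, sumElim_dotProduct_sumElim, sub_dotProduct, sum_dotProduct,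
    dotProduct_sub]
  simp_rw [smul_dotProduct]
  simp only [smul_eq_mul]
  have e : (M.gain xs x θ ⬝ᵥ fun j => M.weights x (xs j) ⬝ᵥ u) =
    ∑ j, M.gain xs x θ j * (M.weights x (xs j) ⬝ᵥ u) := rfl
  rw [e]
  ring

lemma Model.postMean_union (D : Data Θ ι) (δ : Fin q → ℝ) (θ : Θ) :
    M.postMean (D.union ⟨xs, δ⟩) θ = M.postMean D θ +
      M.gain xs D.loc θ ⬝ᵥ (δ - fun j => M.postMean D (xs j)) := by
  have h : (D.union ⟨xs, δ⟩).val - (fun i => M.priorMean ((D.union ⟨xs, δ⟩).loc i)) =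
      Sum.elim (D.val - fun i => M.priorMean (D.loc i)) (δ - fun j => M.priorMean (xs j)) := by
    ext (i | i) <;> rfl
  rw [M.postMean_eq, h, Data.union, M.weights_union_dotProduct]
  simp_rw [M.postMean_eq D]
  rw [add_assoc]
  congr 3
  ext j
  simp only [Pi.sub_apply]
  ring

/-- The right-hand side is free of `δ`: only the posterior mean is random before the batch is
observed. -/
lemma Model.postCov_union (D : Data Θ ι) (δ : Fin q → ℝ) (θ θ' : Θ) :
    M.postCov (D.union ⟨xs, δ⟩).loc θ θ' = M.postCov D.loc θ θ' -
      M.gain xs D.loc θ ⬝ᵥ fun j => M.postCov D.loc (xs j) θ' := by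
  have h : (fun i => M.priorCov θ' (Sum.elim D.loc xs i)) =
      Sum.elim (fun i => M.priorCov θ' (D.loc i)) (fun j => M.priorCov θ' (xs j)) := by
    ext (i | i) <;> rfl
  rw [M.postCov_eq, Data.union, h, M.weights_union_dotProduct, M.postCov_eq]
  simp_rw [M.postCov_eq D.loc (xs _), M.priorCov_isCovarianceFunction.symm θ' (xs _)]
  rw [← sub_sub]
  rfl

lemma Model.postVar_union (D : Data Θ ι) (δ : Fin q → ℝ) (θ : Θ) :
    M.postVar (D.union ⟨xs, δ⟩).loc θ = M.postVar D.loc θ - M.tauSq D.loc xs θ := by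
  rw [postVar, M.postCov_union, M.tauSq_eq, postVar]

end Algebra

/-! ### The predictive law -/

section Predictive

lemma map_dotProduct_multivariateGaussian {κ : Type*} [Fintype κ] [DecidableEq κ]
    (μ : EuclideanSpace ℝ κ) {S : Matrix κ κ ℝ} (hS : S.PosSemidef) (g : κ → ℝ) :
    (multivariateGaussian μ S).map (fun y => g ⬝ᵥ fun i => y i) =
      gaussianReal (g ⬝ᵥ fun i => μ i) (g ⬝ᵥ (S *ᵥ g)).toNNReal := by
  have hL : (fun y : EuclideanSpace ℝ κ => g ⬝ᵥ fun i => y i) = innerSL ℝ (WithLp.toLp 2 g) := by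
    ext y
    simp [PiLp.inner_apply, dotProduct, mul_comm]
  rw [hL, IsGaussian.map_eq_gaussianReal]
  congr 2
  · have := ContinuousLinearMap.integral_comp_id_comm (μ := multivariateGaussian μ S)
      IsGaussian.integrable_id (innerSL ℝ (WithLp.toLp 2 g))
    rw [integral_id_multivariateGaussian] at this
    rw [this, ← hL]
  · have := covarianceBilin_self (μ := multivariateGaussian μ S) IsGaussian.memLp_two_id
      (WithLp.toLp 2 g)
    rw [covarianceBilin_multivariateGaussian hS] at this
    exact this.symm

lemma map_dotProduct_pi_gaussianReal {κ : Type*} [Fintype κ] (g : κ → ℝ) (v : ℝ≥0) :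
    (Measure.pi fun _ : κ => gaussianReal 0 v).map (fun y => g ⬝ᵥ y) =
      gaussianReal 0 ((g ⬝ᵥ g) * v).toNNReal := by
  have hind : iIndepFun (fun (i : κ) (y : κ → ℝ) => g i * y i)
      (Measure.pi fun _ : κ => gaussianReal 0 v) :=
    iIndepFun_pi (X := fun i x => g i * x) fun i => by fun_prop
  have hlaw (i : κ) : HasGaussianLaw (fun y : κ → ℝ => g i * y i)
      (Measure.pi fun _ : κ => gaussianReal 0 v) := by
    have h0 : HasLaw (fun y : κ → ℝ => y i) (gaussianReal 0 v)
        (Measure.pi fun _ : κ => gaussianReal 0 v) :=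
      ⟨(measurable_pi_apply i).aemeasurable, (measurePreserving_eval (fun _ : κ => gaussianReal 0 v) i).map_eq⟩
    exact (gaussianReal_const_mul h0 (g i)).hasGaussianLaw
  have hG := iIndepFun.hasGaussianLaw_fun_sum hlaw hind
  have e : (fun y : κ → ℝ => g ⬝ᵥ y) = fun y => ∑ i, g i * y i := rfl
  rw [e, hG.map_eq_gaussianReal]
  congr 2
  · rw [integral_finsetSum _ fun i _ => (hlaw i).integrable]
    refine Finset.sum_eq_zero fun i _ => ?_
    rw [integral_const_mul, integral_comp_eval (μ := fun _ : κ => gaussianReal 0 v)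
      (f := fun x : ℝ => x) (i := i) aestronglyMeasurable_id, integral_id_gaussianReal, mul_zero]
  · have e' : (fun y : κ → ℝ => ∑ i, g i * y i) = ∑ i, fun y : κ → ℝ => g i * y i := by
      ext y
      simp
    rw [e', variance_sum_pi (μ := fun _ : κ => gaussianReal 0 v) (X := fun i x => g i * x)
      fun i => (memLp_id_gaussianReal 2).const_mul (g i)]
    rw [dotProduct, Finset.sum_mul]
    refine Finset.sum_congr rfl fun i _ => ?_
    rw [variance_const_mul, variance_fun_id_gaussianReal, sq]

variable {p : ℕ} {Θ : Set (EuclideanSpace ℝ (Fin p))} {r : ℕ} (M : Model Θ r)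
variable {ι : Type*} [Fintype ι] [DecidableEq ι] {q : ℕ} (xs : Fin q → Θ)

/-- Signal and noise contribute independent normals, whose variances add up to `gᵀ (c(θ*, θ*) + σ²
I) g`. For `g` the gain this is `τ²`. -/
lemma Model.predictive_map_dotProduct (D : Data Θ ι) (g : Fin q → ℝ) :
    (M.predictive D xs).map (fun δ => g ⬝ᵥ δ) =
      gaussianReal (g ⬝ᵥ fun j => M.postMean D (xs j))
        (g ⬝ᵥ (M.predCov xs D.loc *ᵥ g)).toNNReal := by
  have hC := M.postCovMatrix_posSemidef D.loc xs
  have hd1 : Measurable fun y : EuclideanSpace ℝ (Fin q) => g ⬝ᵥ fun i => y i := by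
    simp only [dotProduct]
    fun_prop
  have hd2 : Measurable fun y : Fin q → ℝ => g ⬝ᵥ y := by
    simp only [dotProduct]
    fun_prop
  rw [predictive, Measure.map_map hd2 (by fun_prop)]
  have e : ((fun δ => g ⬝ᵥ δ) ∘ fun (y : EuclideanSpace ℝ (Fin q) × (Fin q → ℝ)) i =>
      y.1 i + y.2 i) = (fun z : ℝ × ℝ => z.1 + z.2) ∘
        Prod.map (fun y : EuclideanSpace ℝ (Fin q) => g ⬝ᵥ fun i => y i) (fun y => g ⬝ᵥ y) := by
    ext y
    simp [dotProduct, mul_add, Finset.sum_add_distrib]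
  rw [e, ← Measure.map_map (by fun_prop) (hd1.prodMap hd2), ← Measure.map_prod_map _ _ hd1 hd2,
    map_dotProduct_multivariateGaussian _ hC, map_dotProduct_pi_gaussianReal,
    ← Measure.conv, gaussianReal_conv_gaussianReal, add_zero, ← Real.toNNReal_add]
  · congr 2
    rw [predCov, add_mulVec, dotProduct_add, smul_mulVec, one_mulVec, dotProduct_smul,
      Real.coe_toNNReal _ (sq_nonneg _), smul_eq_mul, mul_comm]
  · simpa using hC.dotProduct_mulVec_nonneg g
  · exact mul_nonneg (Finset.sum_nonneg fun i _ => mul_self_nonneg _) (NNReal.coe_nonneg _)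

/-- The law of the look-ahead posterior mean. -/
lemma Model.predictive_map_postMean (D : Data Θ ι) (θ : Θ) :
    (M.predictive D xs).map (fun δ => M.postMean (D.union ⟨xs, δ⟩) θ) =
      (gaussianReal 0 1).map fun z => M.postMean D θ + √(M.tauSq D.loc xs θ) * z := by
  rw [map_affine_gaussianReal _ (M.tauSq_nonneg xs D.loc θ)]
  set g := M.gain xs D.loc θ with hg
  set m := fun j => M.postMean D (xs j)
  have e : (fun δ => M.postMean (D.union ⟨xs, δ⟩) θ) =
      (fun z => (M.postMean D θ - g ⬝ᵥ m) + z) ∘ fun δ => g ⬝ᵥ δ := by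
    ext δ
    rw [M.postMean_union, dotProduct_sub]
    simp only [Function.comp_apply]
    ring
  have hd2 : Measurable fun y : Fin q → ℝ => g ⬝ᵥ y := by
    simp only [dotProduct]
    fun_prop
  rw [e, ← Measure.map_map (by fun_prop) hd2, M.predictive_map_dotProduct,
    gaussianReal_map_const_add, ← M.tauSq_eq_quadratic]
  congr 1
  ring

end Predictive

/-! ### Regularity in the parameter -/

section Regularity

variable {p : ℕ} {Θ : Set (EuclideanSpace ℝ (Fin p))} {r : ℕ} (M : Model Θ r)
variable {ι : Type*} [Fintype ι] [DecidableEq ι] {q : ℕ} (xs : Fin q → Θ)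

omit [Fintype ι] [DecidableEq ι] in
lemma Model.continuous_kvec (x : ι → Θ) : Continuous (M.kvec x) :=
  continuous_pi fun i => M.k_continuous.comp (by fun_prop : Continuous fun θ => (θ, x i))

lemma Model.continuous_resid (x : ι → Θ) : Continuous (M.resid x) := by
  have h := M.continuous_kvec x
  exact (continuous_pi M.h_continuous).sub
    (continuous_const.matrix_mulVec (continuous_const.matrix_mulVec h))

lemma Model.continuous_postMean (D : Data Θ ι) : Continuous (M.postMean D) := by
  have h := M.continuous_kvec D.loc
  have h' := M.continuous_resid D.loc
  unfold postMean
  fun_prop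

lemma Model.continuous_postCov (x : ι → Θ) : Continuous (Function.uncurry (M.postCov x)) := by
  have h := M.continuous_kvec x
  have h' := M.continuous_resid x
  have hk : Continuous fun z : Θ × Θ => M.k z.1 z.2 := M.k_continuous
  unfold postCov Function.uncurry
  fun_prop

lemma Model.continuous_postVar (x : ι → Θ) : Continuous (M.postVar x) :=
  (M.continuous_postCov x).comp (by fun_prop : Continuous fun θ => (θ, θ))

lemma Model.continuous_postCov_left (x : ι → Θ) :
    Continuous fun θ => fun i => M.postCov x (xs i) θ :=
  continuous_pi fun i =>
    (M.continuous_postCov x).comp (by fun_prop : Continuous fun θ => (xs i, θ))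

lemma Model.continuous_gain (x : ι → Θ) : Continuous (M.gain xs x) := by
  exact continuous_const.matrix_mulVec (M.continuous_postCov_left xs x)

lemma Model.continuous_tauSq (x : ι → Θ) : Continuous (M.tauSq x xs) := by
  have h := M.continuous_postCov_left xs x
  have h' := M.continuous_gain xs x
  have e : M.tauSq x xs = fun θ => M.gain xs x θ ⬝ᵥ fun i => M.postCov x (xs i) θ :=
    funext fun θ => M.tauSq_eq xs x θ
  rw [e]
  exact h'.dotProduct h

lemma Model.continuous_postMean_union (D : Data Θ ι) :
    Continuous fun z : (Fin q → ℝ) × Θ => M.postMean (D.union ⟨xs, z.1⟩) z.2 := by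
  have h := M.continuous_postMean D
  have h' := M.continuous_gain xs D.loc
  simp_rw [M.postMean_union]
  fun_prop

lemma Model.measurable_aFun (D : Data Θ ι) : Measurable (M.aFun D) := by
  have h := (M.continuous_postMean D).measurable
  have h' := (M.continuous_postVar D.loc).measurable
  unfold aFun
  fun_prop

lemma Model.measurable_eivIntegrand (D : Data Θ ι) : Measurable (M.eivIntegrand D xs) := by
  have h1 := M.measurable_aFun D
  have h2 := (M.continuous_postVar D.loc).measurable
  have h3 := (M.continuous_tauSq xs D.loc).measurable
  have h4 : Measurable fun θ => M.σ ^ 2 + M.postVar D.loc θ := measurable_const.add h2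
  exact (M.prior_measurable.pow_const 2).mul
    ((measurable_owenT_comp h1 ((h4.sub h3).sqrt.div (h4.add h3).sqrt)).sub
      (measurable_owenT_comp h1 (measurable_const.div (measurable_const.add (measurable_const.mul h2)).sqrt)))

lemma Model.measurable_eimadIntegrand (D : Data Θ ι) : Measurable (M.eimadIntegrand D xs) := by
  have h2 := (M.continuous_postVar D.loc).measurable
  have h3 := (M.continuous_tauSq xs D.loc).measurable
  exact M.prior_measurable.mul (measurable_owenT_comp (M.measurable_aFun D)
    ((h2.sub h3).sqrt.div (measurable_const.add h3).sqrt))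

end Regularity

/-! ### Bayes estimators of a random function -/

section BayesEstimator

variable {T Ω : Type*} [MeasurableSpace T] [MeasurableSpace Ω] {ν : Measure T} [SFinite ν]
  {P : Measure Ω} [IsProbabilityMeasure P]

/-- The bias-variance decomposition. -/
lemma lintegral_sq_sub {X : Ω → ℝ} (hX : MemLp X 2 P) (d : ℝ) :
    ∫⁻ ω, ENNReal.ofReal ((X ω - d) ^ 2) ∂P =
      ENNReal.ofReal (Var[X; P] + (∫ ω, X ω ∂P - d) ^ 2) := by
  have hXi : Integrable X P := hX.integrable (by norm_num)
  have hi : Integrable (fun ω => (X ω - d) ^ 2) P := (hX.sub (memLp_const d)).integrable_sq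
  rw [← ofReal_integral_eq_lintegral_ofReal hi (.of_forall fun ω => sq_nonneg _)]
  congr 1
  have hd : Var[fun ω => X ω - d; P] = Var[X; P] := variance_sub_const hX.aestronglyMeasurable d
  rw [← hd, variance_eq_sub (X := fun ω => X ω - d) (hX.sub (memLp_const d)), integral_sub hXi (integrable_const d)]
  simp

/-- Tonelli reduces the loss to a bias-variance decomposition at each `θ`, minimised by the mean.
The bound `C` only serves to give each `G θ` a finite second moment; square-integrability in `θ`
comes from `hmem`. -/
lemma exists_bayes_estimator_L2 {G : T → Ω → ℝ} (hG : Measurable (Function.uncurry G))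
    {C : T → ℝ} (hC : ∀ θ ω, |G θ ω| ≤ C θ) (hmem : ∀ᵐ ω ∂P, MemLp (fun θ => G θ ω) 2 ν) :
    (∀ d : T → ℝ, MemLp d 2 ν → ∫⁻ θ, ENNReal.ofReal Var[G θ; P] ∂ν ≤
      ∫⁻ ω, ∫⁻ θ, ENNReal.ofReal ((G θ ω - d θ) ^ 2) ∂ν ∂P) ∧
    ∃ d : T → ℝ, MemLp d 2 ν ∧ ∫⁻ ω, ∫⁻ θ, ENNReal.ofReal ((G θ ω - d θ) ^ 2) ∂ν ∂P =
      ∫⁻ θ, ENNReal.ofReal Var[G θ; P] ∂ν := by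
  have hGθ (θ : T) : Measurable (G θ) := hG.of_uncurry_left
  have hGω : Measurable fun z : Ω × T => G z.2 z.1 := hG.comp measurable_swap
  have hGm (θ : T) : MemLp (G θ) 2 P :=
    MemLp.of_bound (hGθ θ).aestronglyMeasurable (C θ) (.of_forall (hC θ))
  have hloss (d : T → ℝ) (hd : AEMeasurable d ν) :
      ∫⁻ ω, ∫⁻ θ, ENNReal.ofReal ((G θ ω - d θ) ^ 2) ∂ν ∂P =
        ∫⁻ θ, ENNReal.ofReal (Var[G θ; P] + (∫ ω, G θ ω ∂P - d θ) ^ 2) ∂ν := by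
    rw [lintegral_lintegral_swap]
    · simp_rw [lintegral_sq_sub (hGm _)]
    · have := hd.comp_snd (μ := P)
      exact ((hGω.aemeasurable.sub this).pow_const 2).ennreal_ofReal
  have hle (d : T → ℝ) (hd : MemLp d 2 ν) : ∫⁻ θ, ENNReal.ofReal Var[G θ; P] ∂ν ≤
      ∫⁻ ω, ∫⁻ θ, ENNReal.ofReal ((G θ ω - d θ) ^ 2) ∂ν ∂P := by
    rw [hloss d hd.aestronglyMeasurable.aemeasurable]
    exact lintegral_mono fun θ => ENNReal.ofReal_le_ofReal (by nlinarith)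
  refine ⟨hle, ?_⟩
  -- If the integrated variance is infinite, so is every loss, and the zero estimator attains the
  -- minimum.
  by_cases htop : ∫⁻ θ, ENNReal.ofReal Var[G θ; P] ∂ν = ∞
  · refine ⟨0, MemLp.zero, ?_⟩
    have h := hle 0 MemLp.zero
    rw [htop, top_le_iff] at h
    rw [h, htop]
  · have he : Measurable fun θ => ∫ ω, G θ ω ∂P :=
      hG.stronglyMeasurable.integral_prod_right.measurable
    have heq : ∫⁻ ω, ∫⁻ θ, ENNReal.ofReal ((G θ ω - ∫ ω, G θ ω ∂P) ^ 2) ∂ν ∂P =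
        ∫⁻ θ, ENNReal.ofReal Var[G θ; P] ∂ν := by
      rw [hloss _ he.aemeasurable]
      simp
    refine ⟨_, ?_, heq⟩
    have hm : Measurable fun ω => ∫⁻ θ, ENNReal.ofReal ((G θ ω - ∫ ω, G θ ω ∂P) ^ 2) ∂ν := by
      refine Measurable.lintegral_prod_right'
        (f := fun z : Ω × T => ENNReal.ofReal ((G z.2 z.1 - ∫ ω, G z.2 ω ∂P) ^ 2)) ?_
      exact ((hGω.sub (he.comp measurable_snd)).pow_const 2).ennreal_ofReal
    have hfin := ae_lt_top hm (by rw [heq]; exact htop)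
    -- One sample path suffices: for some `ω` both the path and its deviation from the mean are in
    -- `L²`, hence so is the mean.
    obtain ⟨ω, h1, h2⟩ := (hmem.and hfin).exists
    have hs : Measurable fun θ => G θ ω - ∫ ω, G θ ω ∂P := hG.of_uncurry_right.sub he
    have h3 : MemLp (fun θ => G θ ω - ∫ ω, G θ ω ∂P) 2 ν := by
      rw [memLp_two_iff_integrable_sq hs.aestronglyMeasurable]
      refine ⟨(hs.pow_const 2).aestronglyMeasurable, ?_⟩
      rwa [hasFiniteIntegral_iff_ofReal (.of_forall fun θ => sq_nonneg _)]
    have h4 := h1.sub h3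
    convert h4 using 1
    ext θ
    simp

end BayesEstimator

/-! ### The Bayes risks under a Gaussian process -/

/-- The variance of `Φ((c - s Z) / σ)` for `Z ~ N(0, 1)`. -/
def cdfVariance (σ c s : ℝ) : ℝ :=
  ∫ z, stdNormalCdf ((c - s * z) / σ) ^ 2 ∂(gaussianReal 0 1) -
    (∫ z, stdNormalCdf ((c - s * z) / σ) ∂(gaussianReal 0 1)) ^ 2

/-- The mean absolute deviation of `Φ((c - s Z) / σ)` around its median, for `Z ~ N(0, 1)`. -/
def cdfMad (σ c s : ℝ) : ℝ :=
  ∫ z, |stdNormalCdf ((c - s * z) / σ) - stdNormalCdf (c / σ)| ∂(gaussianReal 0 1)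

section Deviation

lemma measurable_cdfVariance (σ : ℝ) : Measurable fun x : ℝ × ℝ => cdfVariance σ x.1 x.2 := by
  have h1 : Measurable fun q : (ℝ × ℝ) × ℝ => stdNormalCdf ((q.1.1 - q.1.2 * q.2) / σ) := by
    fun_prop
  exact (h1.pow_const 2).stronglyMeasurable.integral_prod_right.measurable.sub
    (h1.stronglyMeasurable.integral_prod_right.measurable.pow_const 2)

lemma measurable_cdfMad (σ : ℝ) : Measurable fun x : ℝ × ℝ => cdfMad σ x.1 x.2 := by
  have h1 : Measurable fun q : (ℝ × ℝ) × ℝ =>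
      |stdNormalCdf ((q.1.1 - q.1.2 * q.2) / σ) - stdNormalCdf (q.1.1 / σ)| := by
    refine Measurable.abs ?_
    fun_prop
  exact h1.stronglyMeasurable.integral_prod_right.measurable

lemma cdfVariance_eq_variance (σ c s : ℝ) :
    cdfVariance σ c s = Var[fun z => stdNormalCdf ((c - s * z) / σ); gaussianReal 0 1] := by
  rw [variance_eq_sub]
  · rfl
  · exact MemLp.of_bound (Measurable.aestronglyMeasurable (by fun_prop)) 1 (.of_forall fun z => abs_stdNormalCdf_le_one _)

lemma cdfVariance_nonneg (σ c s : ℝ) : 0 ≤ cdfVariance σ c s := by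
  rw [cdfVariance_eq_variance]
  exact variance_nonneg _ _

lemma cdfMad_nonneg (σ c s : ℝ) : 0 ≤ cdfMad σ c s := integral_nonneg fun _ => abs_nonneg _

lemma abs_stdNormalCdf_sub_le_one (x y : ℝ) : |stdNormalCdf x - stdNormalCdf y| ≤ 1 :=
  abs_le.2 ⟨by linarith [stdNormalCdf_nonneg x, stdNormalCdf_le_one y],
    by linarith [stdNormalCdf_nonneg y, stdNormalCdf_le_one x]⟩

lemma cdfMad_le_one (σ c s : ℝ) : cdfMad σ c s ≤ 1 := by
  have h := norm_integral_le_of_norm_le_const (μ := gaussianReal 0 1) (C := 1)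
    (f := fun z => |stdNormalCdf ((c - s * z) / σ) - stdNormalCdf (c / σ)|)
    (.of_forall fun z => by simpa using abs_stdNormalCdf_sub_le_one _ _)
  have h' := (le_abs_self _).trans h
  simp only [probReal_univ, mul_one] at h'
  exact h'

lemma cdfVariance_le_one (σ c s : ℝ) : cdfVariance σ c s ≤ 1 := by
  have h := norm_integral_le_of_norm_le_const (μ := gaussianReal 0 1) (C := 1)
    (f := fun z => stdNormalCdf ((c - s * z) / σ) ^ 2)
    (.of_forall fun z => by
      rw [norm_pow]
      exact pow_le_one₀ (norm_nonneg _) (abs_stdNormalCdf_le_one _))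
  have h' := (le_abs_self _).trans h
  simp only [probReal_univ, mul_one] at h'
  rw [cdfVariance]
  linarith [sq_nonneg (∫ z, stdNormalCdf ((c - s * z) / σ) ∂(gaussianReal 0 1))]

/-- The median minimises the expected absolute deviation. -/
lemma mul_cdfMad_le {σ s a : ℝ} (hσ : 0 < σ) (hs : 0 ≤ s) (c d : ℝ) :
    a * cdfMad σ c s ≤ ∫ z, |a * stdNormalCdf ((c - s * z) / σ) - d| ∂(gaussianReal 0 1) := by
  have hsgn : ∫ z, Real.sign (-z) ∂(gaussianReal 0 1) = 0 := by
    simpa [stdNormalCdf_zero] using integral_sign_sub 0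
  have hi1 : Integrable (fun z => a * |stdNormalCdf ((c - s * z) / σ) - stdNormalCdf (c / σ)|)
      (gaussianReal 0 1) :=
    (integrable_of_abs_le (Measurable.abs (by fun_prop)) 1 fun z => by
      rw [abs_abs]
      exact abs_stdNormalCdf_sub_le_one _ _).const_mul a
  have hi2 : Integrable (fun z => Real.sign (-z) * (a * stdNormalCdf (c / σ) - d))
      (gaussianReal 0 1) :=
    (integrable_of_abs_le (by fun_prop) 1 fun z => abs_sign_le_one _).mul_const _
  have hi3 : Integrable (fun z => |a * stdNormalCdf ((c - s * z) / σ) - d|)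
      (gaussianReal 0 1) :=
    (((integrable_of_abs_le (by fun_prop) 1 fun z => abs_stdNormalCdf_le_one _).const_mul a).sub
      (integrable_const d)).abs
  calc a * cdfMad σ c s
      -- A term of mean zero is added, so that the integrand becomes `sign (-z) * (a Φ((c - s z) /
      -- σ) - d)` for `z ≠ 0`, which is at most its absolute value.
      = ∫ z, (a * |stdNormalCdf ((c - s * z) / σ) - stdNormalCdf (c / σ)| +
          Real.sign (-z) * (a * stdNormalCdf (c / σ) - d)) ∂(gaussianReal 0 1) := by
        rw [integral_add hi1 hi2, integral_mul_const, hsgn, zero_mul, add_zero,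
          integral_const_mul, cdfMad]
    _ ≤ _ := by
        refine integral_mono (hi1.add hi2) hi3 fun z => ?_
        have hmono {x y : ℝ} (h : x ≤ y) : stdNormalCdf (x / σ) ≤ stdNormalCdf (y / σ) :=
          monotone_stdNormalCdf (div_le_div_of_nonneg_right h hσ.le)
        rcases lt_trichotomy z 0 with h | h | h
        · have := hmono (x := c) (y := c - s * z) (by nlinarith)
          simp only [Real.sign_of_pos (neg_pos.2 h), abs_of_nonneg (sub_nonneg.2 this)]
          refine le_trans (le_of_eq ?_) (le_abs_self _)
          ring
        · simp [h]
        · have := hmono (x := c - s * z) (y := c) (by nlinarith)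
          simp only [Real.sign_of_neg (neg_lt_zero.2 h), abs_of_nonpos (sub_nonpos.2 this)]
          refine le_trans (le_of_eq ?_) (neg_le_abs _)
          ring

end Deviation

section Risk

lemma IsGP.cov_self_nonneg {T Ω : Type*} [MeasurableSpace T] [MeasurableSpace Ω]
    {f : T → Ω → ℝ} {m : T → ℝ} {c : T → T → ℝ} {P : Measure Ω} (hf : IsGP f m c P) (θ : T) :
    0 ≤ c θ θ := by
  rw [← hf.covariance, covariance_self hf.measurable.of_uncurry_left.aemeasurable]
  exact variance_nonneg _ _

/-- The risks use the process only through these one-dimensional marginals, and through joint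
measurability for Tonelli. -/
lemma IsGP.map_eq {T Ω : Type*} [MeasurableSpace T] [MeasurableSpace Ω]
    {f : T → Ω → ℝ} {m : T → ℝ} {c : T → T → ℝ} {P : Measure Ω} (hf : IsGP f m c P) (θ : T) :
    P.map (f θ) = (gaussianReal 0 1).map fun z => m θ + √(c θ θ) * z := by
  rw [map_affine_gaussianReal _ (hf.cov_self_nonneg θ),
    (hf.gaussian.hasGaussianLaw_eval θ).map_eq_gaussianReal, hf.mean, ← hf.covariance,
    covariance_self hf.measurable.of_uncurry_left.aemeasurable]

lemma IsGP.integral_comp {T Ω : Type*} [MeasurableSpace T] [MeasurableSpace Ω]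
    {f : T → Ω → ℝ} {m : T → ℝ} {c : T → T → ℝ} {P : Measure Ω} (hf : IsGP f m c P) (θ : T)
    {F : ℝ → ℝ} (hF : Measurable F) :
    ∫ ω, F (f θ ω) ∂P = ∫ z, F (m θ + √(c θ θ) * z) ∂(gaussianReal 0 1) := by
  rw [← integral_map hf.measurable.of_uncurry_left.aemeasurable hF.aestronglyMeasurable,
    hf.map_eq, integral_map (by fun_prop) hF.aestronglyMeasurable]

variable {p : ℕ} {Θ : Set (EuclideanSpace ℝ (Fin p))} {r : ℕ} (M : Model Θ r)
variable {Ω : Type*} [MeasurableSpace Ω] {P : Measure Ω} [IsProbabilityMeasure P]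
variable {f : Θ → Ω → ℝ} {m : Θ → ℝ} {c : Θ → Θ → ℝ}

lemma Model.abs_unnormABC_le (f : Θ → ℝ) (θ : Θ) : |M.unnormABC f θ| ≤ M.prior θ := by
  rw [unnormABC, abs_mul, abs_of_nonneg (M.prior_nonneg θ)]
  exact mul_le_of_le_one_right (M.prior_nonneg θ) (abs_stdNormalCdf_le_one _)

lemma Model.measurable_unnormABC (hf : Measurable (Function.uncurry f)) :
    Measurable (Function.uncurry fun θ ω => M.unnormABC (fun θ => f θ ω) θ) := by
  exact (M.prior_measurable.comp measurable_fst).mul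
    (measurable_stdNormalCdf.comp ((measurable_const.sub hf).div_const M.σ))

lemma Model.variance_unnormABC (hf : IsGP f m c P) (θ : Θ) :
    Var[fun ω => M.unnormABC (fun θ => f θ ω) θ; P] =
      M.prior θ ^ 2 * cdfVariance M.σ (M.ε - m θ) √(c θ θ) := by
  have hm := hf.measurable.of_uncurry_left (x := θ)
  simp only [unnormABC]
  rw [variance_const_mul, variance_eq_sub, cdfVariance]
  · congr 2
    · simp only [Pi.pow_apply]
      rw [hf.integral_comp θ (F := fun x => stdNormalCdf ((M.ε - x) / M.σ) ^ 2) (by fun_prop)]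
      simp_rw [sub_sub]
    · rw [hf.integral_comp θ (F := fun x => stdNormalCdf ((M.ε - x) / M.σ)) (by fun_prop)]
      simp_rw [sub_sub]
  · exact MemLp.of_bound (Measurable.aestronglyMeasurable (by fun_prop)) 1 (.of_forall fun z => abs_stdNormalCdf_le_one _)

lemma sigmaFinite_volume_subtype {E : Type*} [MeasureSpace E] [SigmaFinite (volume : Measure E)]
    {s : Set E} (hs : MeasurableSet s) : SigmaFinite (volume : Measure s) :=
  .of_map _ measurable_subtype_coe.aemeasurable
    (by
      have h : (volume : Measure s).map Subtype.val = volume.restrict s :=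
        map_comap_subtype_coe hs volume
      rw [h]
      infer_instance)

/-- The Bayes risk for the squared loss is the integrated variance; it is attained. -/
lemma Model.riskL2_eq (hΘ : MeasurableSet Θ) (hf : IsGP f m c P)
    (hmem : ∀ᵐ ω ∂P, MemLp (M.unnormABC fun θ => f θ ω) 2) :
    M.riskL2 f P = ∫⁻ θ, ENNReal.ofReal
      (M.prior θ ^ 2 * cdfVariance M.σ (M.ε - m θ) √(c θ θ)) ∧
    ∃ d : Θ → ℝ, MemLp d 2 ∧ M.expLossL2 f P d = M.riskL2 f P := by
  have := sigmaFinite_volume_subtype hΘ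
  obtain ⟨h1, d, hd, h2⟩ := exists_bayes_estimator_L2 (P := P)
    (M.measurable_unnormABC hf.measurable) (fun θ ω => M.abs_unnormABC_le _ θ) hmem
  simp_rw [M.variance_unnormABC hf] at h1 h2
  have e : M.riskL2 f P = ∫⁻ θ, ENNReal.ofReal
      (M.prior θ ^ 2 * cdfVariance M.σ (M.ε - m θ) √(c θ θ)) :=
    le_antisymm ((iInf₂_le d hd).trans h2.le) (le_iInf₂ h1)
  exact ⟨e, d, hd, h2.trans e.symm⟩

lemma Model.memLp_one_prior : MemLp M.prior 1 := by
  rw [memLp_one_iff_integrable]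
  refine ⟨M.prior_measurable.aestronglyMeasurable, ?_⟩
  rw [hasFiniteIntegral_iff_ofReal (.of_forall M.prior_nonneg), M.prior_lintegral]
  exact ENNReal.one_lt_top

/-- The Bayes risk for the absolute loss is the integrated mean absolute deviation around the
median; it is attained. -/
lemma Model.riskL1_eq (hΘ : MeasurableSet Θ) (hf : IsGP f m c P) (hm : Measurable m) :
    M.riskL1 f P = ∫⁻ θ, ENNReal.ofReal
      (M.prior θ * cdfMad M.σ (M.ε - m θ) √(c θ θ)) ∧
    ∃ d : Θ → ℝ, MemLp d 1 ∧ M.expLossL1 f P d = M.riskL1 f P := by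
  have := sigmaFinite_volume_subtype hΘ
  have hG := M.measurable_unnormABC hf.measurable
  have hloss (d : Θ → ℝ) (hd : AEMeasurable d) : M.expLossL1 f P d =
      ∫⁻ θ, ENNReal.ofReal (∫ z, |M.prior θ * stdNormalCdf ((M.ε - m θ - √(c θ θ) * z) / M.σ) -
        d θ| ∂(gaussianReal 0 1)) := by
    simp only [expLossL1, lossL1]
    rw [lintegral_lintegral_swap]
    · congr 1
      ext θ
      have hGθ : Measurable fun ω => M.unnormABC (fun θ => f θ ω) θ := hG.of_uncurry_left
      rw [← ofReal_integral_eq_lintegral_ofReal _ (.of_forall fun ω => abs_nonneg _)]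
      · simp only [unnormABC]
        rw [hf.integral_comp θ (F := fun x => |M.prior θ * stdNormalCdf ((M.ε - x) / M.σ) - d θ|)
          (Measurable.abs (by fun_prop))]
        simp_rw [sub_sub]
      · exact ((integrable_of_abs_le hGθ (M.prior θ) fun ω => M.abs_unnormABC_le _ θ).sub
          (integrable_const _)).abs
    · have := hd.comp_snd (μ := P)
      have hGω := (hG.comp measurable_swap).aemeasurable (μ := P.prod volume)
      exact (hGω.sub this).abs.ennreal_ofReal
  -- The pointwise median; it is dominated by the prior density, hence integrable without further
  -- assumptions.
  set d₀ : Θ → ℝ := fun θ => M.prior θ * stdNormalCdf ((M.ε - m θ) / M.σ) with hd₀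
  have hd₀m : Measurable d₀ :=
    M.prior_measurable.mul (measurable_stdNormalCdf.comp ((measurable_const.sub hm).div_const _))
  have hd₀L : MemLp d₀ 1 :=
    M.memLp_one_prior.mono hd₀m.aestronglyMeasurable (.of_forall fun θ =>
      (M.abs_unnormABC_le m θ).trans (le_abs_self _))
  have h2 : M.expLossL1 f P d₀ = ∫⁻ θ, ENNReal.ofReal
      (M.prior θ * cdfMad M.σ (M.ε - m θ) √(c θ θ)) := by
    rw [hloss d₀ hd₀m.aemeasurable]
    congr 1
    ext θ
    simp only [hd₀, ← mul_sub, abs_mul, abs_of_nonneg (M.prior_nonneg θ)]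
    rw [integral_const_mul, cdfMad]
  have h1 (d : Θ → ℝ) (hd : MemLp d 1) : ∫⁻ θ, ENNReal.ofReal
      (M.prior θ * cdfMad M.σ (M.ε - m θ) √(c θ θ)) ≤ M.expLossL1 f P d := by
    rw [hloss d hd.aestronglyMeasurable.aemeasurable]
    exact lintegral_mono fun θ => ENNReal.ofReal_le_ofReal
      (mul_cdfMad_le M.σ_pos (Real.sqrt_nonneg _) _ _)
  have e : M.riskL1 f P = ∫⁻ θ, ENNReal.ofReal
      (M.prior θ * cdfMad M.σ (M.ε - m θ) √(c θ θ)) :=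
    le_antisymm ((iInf₂_le d₀ hd₀L).trans h2.le) (le_iInf₂ h1)
  exact ⟨e, d₀, hd₀L, h2.trans e.symm⟩

end Risk

/-! ### Averaging over the future discrepancies -/

section LookAhead

variable {p : ℕ} {Θ : Set (EuclideanSpace ℝ (Fin p))} {r : ℕ} (M : Model Θ r)
variable {ι : Type*} [Fintype ι] [DecidableEq ι] {q : ℕ} (xs : Fin q → Θ)

instance (D : Data Θ ι) : IsProbabilityMeasure (M.predictive D xs) :=
  Measure.isProbabilityMeasure_map (Measurable.aemeasurable (by fun_prop))

/-- Common to both losses, with `H` to be `cdfVariance` or `cdfMad`. Tonelli puts `δ` inside, where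
it enters only through the look-ahead mean, whose law is `N(m, τ²)`. -/
lemma Model.lintegral_predictive (hΘ : MeasurableSet Θ) (D : Data Θ ι) {w : Θ → ℝ}
    (hw : Measurable w) (hw0 : ∀ θ, 0 ≤ w θ) {H : ℝ → ℝ → ℝ}
    (hH : Measurable fun x : ℝ × ℝ => H x.1 x.2) (hH0 : ∀ x y, 0 ≤ H x y) {C : ℝ}
    (hHC : ∀ x y, H x y ≤ C) :
    ∫⁻ δ, ∫⁻ θ, ENNReal.ofReal (w θ * H (M.ε - M.postMean (D.union ⟨xs, δ⟩) θ)
      √(M.postVar (D.union ⟨xs, δ⟩).loc θ)) ∂volume ∂(M.predictive D xs) =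
    ∫⁻ θ, ENNReal.ofReal (w θ * ∫ y, H (M.ε - M.postMean D θ - √(M.tauSq D.loc xs θ) * y)
      √(M.postVar D.loc θ - M.tauSq D.loc xs θ) ∂(gaussianReal 0 1)) := by
  have := sigmaFinite_volume_subtype hΘ
  have hm := (M.continuous_postMean_union xs D).measurable
  have hv : Measurable fun θ => √(M.postVar D.loc θ - M.tauSq D.loc xs θ) :=
    ((M.continuous_postVar D.loc).measurable.sub (M.continuous_tauSq xs D.loc).measurable).sqrt
  simp_rw [M.postVar_union]
  rw [lintegral_lintegral_swap]
  · congr 1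
    ext θ
    set s := √(M.postVar D.loc θ - M.tauSq D.loc xs θ)
    have hHs : Measurable fun x => H (M.ε - x) s :=
      hH.comp ((measurable_const.sub measurable_id).prodMk measurable_const)
    have hF : Measurable fun x => ENNReal.ofReal (w θ * H (M.ε - x) s) :=
      (hHs.const_mul _).ennreal_ofReal
    have hmθ : Measurable fun δ => M.postMean (D.union ⟨xs, δ⟩) θ := hm.of_uncurry_right
    have hHy : Measurable fun y => H (M.ε - (M.postMean D θ + √(M.tauSq D.loc xs θ) * y)) s :=
      hHs.comp (g := fun x => H (M.ε - x) s) (by fun_prop)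
    rw [← lintegral_map hF hmθ, M.predictive_map_postMean, lintegral_map hF (by fun_prop),
      ← ofReal_integral_eq_lintegral_ofReal, integral_const_mul]
    · simp_rw [sub_sub]
    · refine (integrable_of_abs_le hHy C fun y => ?_).const_mul _
      rw [abs_of_nonneg (hH0 _ _)]
      exact hHC _ _
    · exact .of_forall fun y => mul_nonneg (hw0 θ) (hH0 _ _)
  · have h1 : Measurable fun z : (Fin q → ℝ) × Θ =>
        H (M.ε - M.postMean (D.union ⟨xs, z.1⟩) z.2)
          √(M.postVar D.loc z.2 - M.tauSq D.loc xs z.2) :=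
      hH.comp ((measurable_const.sub hm).prodMk (hv.comp measurable_snd))
    exact ((hw.comp measurable_snd).mul h1).ennreal_ofReal.aemeasurable

lemma Model.integral_cdfVariance (D : Data Θ ι) (θ : Θ)
    (h : M.tauSq D.loc xs θ ≤ M.postVar D.loc θ) :
    M.prior θ ^ 2 * ∫ y, cdfVariance M.σ (M.ε - M.postMean D θ - √(M.tauSq D.loc xs θ) * y)
      √(M.postVar D.loc θ - M.tauSq D.loc xs θ) ∂(gaussianReal 0 1) =
      2 * M.eivIntegrand D xs θ := by
  have h1 : √(M.tauSq D.loc xs θ) ^ 2 = M.tauSq D.loc xs θ :=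
    Real.sq_sqrt (M.tauSq_nonneg xs D.loc θ)
  have h2 : √(M.postVar D.loc θ - M.tauSq D.loc xs θ) ^ 2 =
      M.postVar D.loc θ - M.tauSq D.loc xs θ := Real.sq_sqrt (sub_nonneg.2 h)
  simp only [cdfVariance]
  rw [integral_variance_stdNormalCdf _ _ _ M.σ_pos, h1, h2, eivIntegrand, aFun]
  rw [show M.σ ^ 2 + (M.postVar D.loc θ - M.tauSq D.loc xs θ) + M.tauSq D.loc xs θ =
      M.σ ^ 2 + M.postVar D.loc θ by ring,
    show M.σ ^ 2 + (M.postVar D.loc θ - M.tauSq D.loc xs θ) + 2 * M.tauSq D.loc xs θ =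
      M.σ ^ 2 + M.postVar D.loc θ + M.tauSq D.loc xs θ by ring,
    sub_add_cancel, ← add_sub_assoc]
  ring

lemma Model.integral_cdfMad (D : Data Θ ι) (θ : Θ)
    (h : M.tauSq D.loc xs θ ≤ M.postVar D.loc θ) :
    M.prior θ * ∫ y, cdfMad M.σ (M.ε - M.postMean D θ - √(M.tauSq D.loc xs θ) * y)
      √(M.postVar D.loc θ - M.tauSq D.loc xs θ) ∂(gaussianReal 0 1) =
      2 * M.eimadIntegrand D xs θ := by
  have h1 : √(M.tauSq D.loc xs θ) ^ 2 = M.tauSq D.loc xs θ :=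
    Real.sq_sqrt (M.tauSq_nonneg xs D.loc θ)
  have h2 : √(M.postVar D.loc θ - M.tauSq D.loc xs θ) ^ 2 =
      M.postVar D.loc θ - M.tauSq D.loc xs θ := Real.sq_sqrt (sub_nonneg.2 h)
  simp only [cdfMad]
  rw [integral_abs_stdNormalCdf_sub _ _ (Real.sqrt_nonneg _) M.σ_pos, h1, h2, eimadIntegrand, aFun]
  rw [show M.σ ^ 2 + M.tauSq D.loc xs θ + (M.postVar D.loc θ - M.tauSq D.loc xs θ) =
      M.σ ^ 2 + M.postVar D.loc θ by ring]
  ring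

/-- Twice the integrand is `π²` times an average of variances, so the two values of `T` need not be
compared. -/
lemma Model.eivIntegrand_nonneg (D : Data Θ ι) (θ : Θ)
    (h : M.tauSq D.loc xs θ ≤ M.postVar D.loc θ) : 0 ≤ M.eivIntegrand D xs θ := by
  have h1 := M.integral_cdfVariance xs D θ h
  have h2 := mul_nonneg (sq_nonneg (M.prior θ)) (integral_nonneg (μ := gaussianReal 0 1) fun y =>
    cdfVariance_nonneg M.σ (M.ε - M.postMean D θ - √(M.tauSq D.loc xs θ) * y)
      √(M.postVar D.loc θ - M.tauSq D.loc xs θ))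
  linarith

lemma Model.eimadIntegrand_nonneg (D : Data Θ ι) (θ : Θ) : 0 ≤ M.eimadIntegrand D xs θ :=
  mul_nonneg (M.prior_nonneg θ) (owenT_nonneg _ (by positivity))

lemma Model.integrable_eivIntegrand (D : Data Θ ι) (hM : MemLp M.prior 2) :
    Integrable (M.eivIntegrand D xs) := by
  refine hM.integrable_sq.mono (M.measurable_eivIntegrand xs D).aestronglyMeasurable
    (.of_forall fun θ => ?_)
  rw [eivIntegrand, norm_mul]
  refine mul_le_of_le_one_right (norm_nonneg _) ((norm_sub_le _ _).trans ?_)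
  refine (add_le_add (abs_owenT_le _ _) (abs_owenT_le _ _)).trans ?_
  norm_num

lemma Model.integrable_eimadIntegrand (D : Data Θ ι) : Integrable (M.eimadIntegrand D xs) := by
  refine (memLp_one_iff_integrable.1 M.memLp_one_prior).mono
    (M.measurable_eimadIntegrand xs D).aestronglyMeasurable (.of_forall fun θ => ?_)
  rw [eimadIntegrand, norm_mul]
  refine mul_le_of_le_one_right (norm_nonneg _) ((abs_owenT_le _ _).trans ?_)
  norm_num

lemma Model.memLp_unnormABC {f : Θ → ℝ} (hf : Measurable f) (hM : MemLp M.prior 2) :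
    MemLp (M.unnormABC f) 2 := by
  refine hM.mono (M.prior_measurable.mul (measurable_stdNormalCdf.comp
    ((measurable_const.sub hf).div_const _))).aestronglyMeasurable (.of_forall fun θ => ?_)
  exact (M.abs_unnormABC_le f θ).trans (le_abs_self _)

variable {Ω : Type*} [MeasurableSpace Ω] {P : (Fin q → ℝ) → Measure Ω}
  [∀ δ, IsProbabilityMeasure (P δ)] {f : (Fin q → ℝ) → Θ → Ω → ℝ}

omit [∀ δ, IsProbabilityMeasure (P δ)] in
-- The difference `s² - τ²` is the variance of the look-ahead process at `θ`; as it does not depend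
-- on the data values, `δ = 0` will do.
lemma Model.IsLookahead.tauSq_le {D : Data Θ ι} (hf : M.IsLookahead D xs f P) (θ : Θ) :
    M.tauSq D.loc xs θ ≤ M.postVar D.loc θ := by
  have h := (hf 0).cov_self_nonneg θ
  have h' := M.postVar_union xs D 0 θ
  rw [postVar] at h'
  linarith

lemma Model.EIV_eq (hΘ : MeasurableSet Θ) {D : Data Θ ι} (hf : M.IsLookahead D xs f P)
    (hmem : ∀ δ, ∀ᵐ ω ∂(P δ), MemLp (M.unnormABC fun θ => f δ θ ω) 2) :
    M.EIV D xs f P = 2 * ∫⁻ θ, ENNReal.ofReal (M.eivIntegrand D xs θ) := by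
  have h1 (δ) := (M.riskL2_eq hΘ (hf δ) (hmem δ)).1
  simp only [EIV, h1]
  have h2 := M.lintegral_predictive xs hΘ D (M.prior_measurable.pow_const 2)
    (fun θ => sq_nonneg _) (measurable_cdfVariance M.σ) (cdfVariance_nonneg M.σ)
    (cdfVariance_le_one M.σ)
  simp_rw [M.integral_cdfVariance xs D _ (IsLookahead.tauSq_le M xs hf _)] at h2
  refine h2.trans ?_
  simp_rw [ENNReal.ofReal_mul zero_le_two]
  rw [lintegral_const_mul _ (M.measurable_eivIntegrand xs D).ennreal_ofReal]
  simp

lemma Model.EIMAD_eq (hΘ : MeasurableSet Θ) {D : Data Θ ι} (hf : M.IsLookahead D xs f P) :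
    M.EIMAD D xs f P = 2 * ∫⁻ θ, ENNReal.ofReal (M.eimadIntegrand D xs θ) := by
  have h1 (δ) := (M.riskL1_eq hΘ (hf δ) (M.continuous_postMean _).measurable).1
  simp only [EIMAD, h1]
  have h2 := M.lintegral_predictive xs hΘ D M.prior_measurable
    M.prior_nonneg (measurable_cdfMad M.σ) (cdfMad_nonneg M.σ) (cdfMad_le_one M.σ)
  simp_rw [M.integral_cdfMad xs D _ (IsLookahead.tauSq_le M xs hf _)] at h2
  refine h2.trans ?_
  simp_rw [ENNReal.ofReal_mul zero_le_two]
  rw [lintegral_const_mul _ (M.measurable_eimadIntegrand xs D).ennreal_ofReal]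
  simp

end LookAhead

lemma two_mul_lintegral_ofReal {α : Type*} [MeasurableSpace α] {μ : Measure α} {g : α → ℝ}
    (hg : Integrable g μ) (hg0 : ∀ x, 0 ≤ g x) :
    2 * ∫⁻ x, ENNReal.ofReal (g x) ∂μ = ENNReal.ofReal (2 * ∫ x, g x ∂μ) := by
  rw [← ofReal_integral_eq_lintegral_ofReal hg (.of_forall hg0), ENNReal.ofReal_mul zero_le_two]
  simp

end BayesABC

end

theorem proposition1 {p r t q : ℕ} {Θ : Set (EuclideanSpace ℝ (Fin p))} (hΘ : MeasurableSet Θ)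
    (M : BayesABC.Model Θ r) (D : BayesABC.Data Θ (Fin t)) (xs : Fin q → Θ)
    {Ω : Type*} [MeasurableSpace Ω]
    (P : (Fin q → ℝ) → Measure Ω) [∀ δ, IsProbabilityMeasure (P δ)]
    (f : (Fin q → ℝ) → Θ → Ω → ℝ) (hf : M.IsLookahead D xs f P) :
    -- EIV; the unnormalised ABC posterior is supposed to be square-integrable
    ((∀ δ, ∀ᵐ ω ∂(P δ), MemLp (M.unnormABC fun θ => f δ θ ω) 2) →
      (∀ δ, ∃ d : Θ → ℝ, MemLp d 2 ∧ M.expLossL2 (f δ) (P δ) d = M.riskL2 (f δ) (P δ)) ∧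
      (∀ θ, 0 ≤ M.eivIntegrand D xs θ) ∧
      M.EIV D xs f P = 2 * ∫⁻ θ, ENNReal.ofReal (M.eivIntegrand D xs θ)) ∧
    (MemLp M.prior 2 →
      Integrable (M.eivIntegrand D xs) ∧
      M.EIV D xs f P = ENNReal.ofReal (2 * ∫ θ, M.eivIntegrand D xs θ)) ∧
    -- EIMAD
    ((∀ δ, ∃ d : Θ → ℝ, MemLp d 1 ∧ M.expLossL1 (f δ) (P δ) d = M.riskL1 (f δ) (P δ)) ∧
      (∀ θ, 0 ≤ M.eimadIntegrand D xs θ) ∧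
      Integrable (M.eimadIntegrand D xs) ∧
      M.EIMAD D xs f P = ENNReal.ofReal (2 * ∫ θ, M.eimadIntegrand D xs θ)) := by
  have hτ := BayesABC.Model.IsLookahead.tauSq_le M xs hf
  have hnn : ∀ θ, 0 ≤ M.eivIntegrand D xs θ := fun θ => M.eivIntegrand_nonneg xs D θ (hτ θ)
  refine ⟨fun hmem => ⟨fun δ => (M.riskL2_eq hΘ (hf δ) (hmem δ)).2, hnn,
    M.EIV_eq xs hΘ hf hmem⟩, fun hM => ?_, ?_⟩
  · have hi := M.integrable_eivIntegrand xs D hM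
    refine ⟨hi, ?_⟩
    -- A square-integrable prior density dominates every path of the unnormalised posterior.
    rw [M.EIV_eq xs hΘ hf fun δ => .of_forall fun ω =>
      M.memLp_unnormABC (hf δ).measurable.of_uncurry_right hM]
    exact BayesABC.two_mul_lintegral_ofReal hi hnn
  · have hi := M.integrable_eimadIntegrand xs D
    have hnn' := M.eimadIntegrand_nonneg xs D
    refine ⟨fun δ => (M.riskL1_eq hΘ (hf δ) (M.continuous_postMean _).measurable).2, hnn', hi, ?_⟩
    rw [M.EIMAD_eq xs hΘ hf]
    exact BayesABC.two_mul_lintegral_ofReal hi hnn'
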